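/- Let $k$ be a field. A Kupisch series of length $n\ge 1$ is a sequence $c=(c_1,\dots,c_n)$ of positive integers, indexed cyclically modulo $n$, with $c_i\le c_{i+1}+1$ for all $i$. The Nakayama algebra $\Lambda(c)$ is the path algebra over $k$ of the cyclic quiver with vertices $1,\dots,n$ and arrows $\alpha_i:i\to i+1$ (indices modulo $n$), modulo the relations $\alpha_{i+c_i-1}\cdots\alpha_{i+1}\alpha_i=0$ for all $i$. Its indecomposable projective modules $P_i$ are uniserial of length $c_i$ with top the simple module $S_i$, followed by $S_{i+1},S_{i+2},\dots$. It is a (connected) cyclic Nakayama algebra if $c_i\ge 2$ for all $i$; if some $c_i=1$, it is a product of linear Nakayama algebras. For $m\ge 1$, a $k$-algebra $A'$ is an $m$-fold covering of a $k$-algebra $A$ if there is a Kupisch series $d=(d_1,\dots,d_r)$ such that $A\cong\Lambda(d)$ and $A'\cong\Lambda(d,\dots,d)$, where $d$ is repeated $m$ times. A double covering is a $2$-fold covering. For a cyclic Nakayama algebra $\Lambda=\Lambda(c)$, let $\mathcal S(\Lambda)$ be the set of the simple modules that occur as the socle of an indecomposable projective module, let $\mathcal S'(\Lambda)=\{S_{j+1}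 : S_j\in\mathcal S(\Lambda)\}$, and let $$\varepsilon(\Lambda)=\operatorname{End}_\Lambda\Bigl(\bigoplus_{S\in\mathcal S'(\Lambda)}P(S)\Bigr)$$ be the syzygy filtered algebra, where $P(S)$ is the projective cover of $S$ and endomorphisms are composed in the order for which $\operatorname{Hom}_\Lambda(\bigoplus P(S),-)$ takes $\Lambda$-modules to $\varepsilon(\Lambda)$-modules on the same side. A finite-dimensional algebra is called a higher Auslander algebra if its dominant dimension equals its global dimension. **Theorem.** Let $\Lambda=\Lambda(c_1,\dots,c_n)$ be a cyclic Nakayama algebra over $k$, let $m\ge 1$, and let $\Lambda'=\Lambda(c_1,\dots,c_n,\dots,c_1,\dots,c_n)$ be its $m$-fold covering. Then 1. $\varepsilon(\Lambda')$ is an $m$-fold covering of $\varepsilon(\Lambda)$; in particular, if $\Lambda'$ is the double covering of $\Lambda$, then $\varepsilon(\Lambda')$ is a double covering of $\varepsilon(\Lambda)$. 2. If $\Lambda$ is a higher Auslander algebra, then $\Lambda'$ is a higher Auslander algebra, and $\operatorname{gldim}\Lambda'=\operatorname{gldim}\Lambda$. -/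

import Mathlib

open scoped DirectSum

universe u

/-! ## Homological dimensions -/

/-- The socle of a module: the sum of its simple submodules. -/
def moduleSocle (R M : Type*) [Ring R] [AddCommGroup M] [Module R M] : Submodule R M :=
  sSup {N : Submodule R M | IsSimpleModule R N}

/-- A submodule is essential if it meets every nonzero submodule nontrivially. -/
def IsEssentialSubmodule {R M : Type*} [Ring R] [AddCommGroup M] [Module R M]
    (N : Submodule R M) : Prop :=
  ∀ L : Submodule R M, L ≠ ⊥ → N ⊓ L ≠ ⊥

/-- A minimal injective resolution `0 → M → I 0 → I 1 → ⋯`: the sequence is exact, every `I j` is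
injective, and it is an essential extension of the image of the preceding map. -/
structure MinimalInjectiveResolution (R : Type u) [Ring R] (M : Type u) [AddCommGroup M]
    [Module R M] where
  I : ℕ → ModuleCat.{u} R
  ι : M →ₗ[R] I 0
  d : ∀ j : ℕ, I j →ₗ[R] I (j + 1)
  injective : ∀ j : ℕ, Module.Injective R (I j)
  ι_injective : Function.Injective ι
  exact_zero : Function.Exact ι (d 0)
  exact_succ : ∀ j : ℕ, Function.Exact (d j) (d (j + 1))
  essential_zero : IsEssentialSubmodule (LinearMap.range ι)
  essential_succ : ∀ j : ℕ, IsEssentialSubmodule (LinearMap.range (d j))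

/-- The dominant dimension of `R`: the supremum of all `t` such that the first `t` terms
`I 0, …, I (t - 1)` of the minimal injective resolution of `R` are projective. -/
noncomputable def dominantDimension (R : Type u) [Ring R] : ℕ∞ :=
  sSup {t : ℕ∞ | ∃ X : MinimalInjectiveResolution R R,
    ∀ j : ℕ, (j : ℕ∞) < t → Module.Projective R (X.I j)}

/-- The global dimension of `R`: the supremum of the projective dimensions of the finitely
generated `R`-modules. -/
noncomputable def globalDimension (R : Type u) [Ring R] : WithBot ℕ∞ :=
  ⨆ (M : ModuleCat.{u} R) (_ : Module.Finite R M), CategoryTheory.projectiveDimension M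

/-- Higher Auslander algebras: the dominant dimension equals the global dimension. -/
def IsHigherAuslander (R : Type u) [Ring R] : Prop :=
  (dominantDimension R : WithBot ℕ∞) = globalDimension R

/-! ## Nakayama algebras -/

/-- A Kupisch series `(c i)`, indexed cyclically by `ℤ/n`: positive integers with
`c i ≤ c (i + 1) + 1`.  Entries equal to `1` are allowed; they belong to simple projective modules,
so that products of linear Nakayama algebras are covered as well. -/
def IsKupischSeries {n : ℕ} (c : ZMod n → ℕ) : Prop :=
  (∀ i, 1 ≤ c i) ∧ ∀ i, c i ≤ c (i + 1) + 1

/-- The Kupisch series of a (connected) cyclic Nakayama algebra: all entries are at least `2`,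
that is, no arrow of the cyclic quiver is a relation. -/
def IsCyclicKupischSeries {n : ℕ} (c : ZMod n → ℕ) : Prop :=
  (∀ i, 2 ≤ c i) ∧ ∀ i, c i ≤ c (i + 1) + 1

/-- The series `(c₁, …, cₙ, c₁, …, cₙ, …, c₁, …, cₙ)`, in which `c` is repeated `m` times. -/
def repeatSeries (m : ℕ) {n : ℕ} (c : ZMod n → ℕ) : ZMod (m * n) → ℕ :=
  fun i => c (ZMod.castHom (dvd_mul_left n m) (ZMod n) i)

namespace NakayamaAlgebra

/-- Vertices and arrows of the cyclic quiver with `n` vertices; the arrow `arrow i` goes from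
`i` to `i + 1`. -/
inductive Gen (n : ℕ) : Type
  | vertex (i : ZMod n) : Gen n
  | arrow (i : ZMod n) : Gen n

section

variable (k : Type u) [Field k] {n : ℕ}

/-- The path `α_{i+l-1} ⋯ α_{i+1} α_i` of length `l` starting at `i`, in the free algebra. -/
noncomputable def freePath (i : ZMod n) : ℕ → FreeAlgebra k (Gen n)
  | 0 => FreeAlgebra.ι k (Gen.vertex i)
  | l + 1 => FreeAlgebra.ι k (Gen.arrow (i + (l : ZMod n))) * freePath i l

/-- The relations of the path algebra of the cyclic quiver (paths are composed like functions, so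
that `α_i = e_{i+1} α_i e_i`), together with the relations that for each `i` the path of
length `c i` starting at `i` is zero. -/
inductive Rel [NeZero n] (c : ZMod n → ℕ) : FreeAlgebra k (Gen n) → FreeAlgebra k (Gen n) → Prop
  | idem (i : ZMod n) : Rel c
      (FreeAlgebra.ι k (Gen.vertex i) * FreeAlgebra.ι k (Gen.vertex i))
      (FreeAlgebra.ι k (Gen.vertex i))
  | orth (i j : ZMod n) : i ≠ j → Rel c
      (FreeAlgebra.ι k (Gen.vertex i) * FreeAlgebra.ι k (Gen.vertex j)) 0
  | sum_vertex : Rel c (∑ i : ZMod n, FreeAlgebra.ι k (Gen.vertex i)) 1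
  | source (i : ZMod n) : Rel c
      (FreeAlgebra.ι k (Gen.arrow i) * FreeAlgebra.ι k (Gen.vertex i))
      (FreeAlgebra.ι k (Gen.arrow i))
  | target (i : ZMod n) : Rel c
      (FreeAlgebra.ι k (Gen.vertex (i + 1)) * FreeAlgebra.ι k (Gen.arrow i))
      (FreeAlgebra.ι k (Gen.arrow i))
  | zero (i : ZMod n) : Rel c (freePath k i (c i)) 0

end

end NakayamaAlgebra

/-- The Nakayama algebra over `k` with Kupisch series `c`: the path algebra of the cyclic quiver
with `n` vertices modulo the paths of length `c i` starting at `i`.  For a Kupisch series `c`, the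
paths of length less than `c i` starting at `i`, for all `i`, form a basis. -/
def NakayamaAlgebra (k : Type u) [Field k] {n : ℕ} [NeZero n] (c : ZMod n → ℕ) : Type u :=
  RingQuot (NakayamaAlgebra.Rel k c)

namespace NakayamaAlgebra

variable (k : Type u) [Field k] {n : ℕ} [NeZero n] (c : ZMod n → ℕ)

noncomputable instance : Ring (NakayamaAlgebra k c) :=
  inferInstanceAs (Ring (RingQuot (NakayamaAlgebra.Rel k c)))

noncomputable instance : Algebra k (NakayamaAlgebra k c) :=
  inferInstanceAs (Algebra k (RingQuot (NakayamaAlgebra.Rel k c)))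

/-- The quotient map from the free algebra. -/
noncomputable def mk : FreeAlgebra k (Gen n) →ₐ[k] NakayamaAlgebra k c :=
  RingQuot.mkAlgHom k (NakayamaAlgebra.Rel k c)

/-- The idempotent at the vertex `i`. -/
noncomputable def e (i : ZMod n) : NakayamaAlgebra k c :=
  mk k c (FreeAlgebra.ι k (Gen.vertex i))

/-- The indecomposable projective left module `P_i = Λ e_i`; it is uniserial of length `c i`, with
composition factors `S_i, S_{i+1}, …` from top to socle. -/
noncomputable def P (i : ZMod n) : Submodule (NakayamaAlgebra k c) (NakayamaAlgebra k c) :=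
  Submodule.span (NakayamaAlgebra k c) {e k c i}

/-- The simple module `S_i`, the top of `P_i`. -/
abbrev S (i : ZMod n) : Type u :=
  P k c i ⧸ Module.jacobson (NakayamaAlgebra k c) (P k c i)

/-- The set `𝒮(Λ)` of (indices of) the socles of the indecomposable projective modules. -/
def socles : Set (ZMod n) :=
  {j | ∃ i : ZMod n,
    Nonempty (moduleSocle (NakayamaAlgebra k c) (P k c i) ≃ₗ[NakayamaAlgebra k c] S k c j)}

/-- The set `𝒮'(Λ)` of the indices that are one cyclically larger than those in `𝒮(Λ)`. -/
def shiftedSocles : Set (ZMod n) :=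
  (fun j => j + 1) '' socles k c

/-- The module `⨁ P(S)`, over `S` in `𝒮'(Λ)`. -/
abbrev generatorModule : Type u :=
  ⨁ j : shiftedSocles k c, P k c j

/-- The syzygy filtered algebra `ε(Λ)`, the endomorphism algebra of `⨁ P(S)` over `S` in `𝒮'(Λ)`.
Endomorphisms of left modules are composed on the opposite side, so that `Hom(⨁ P(S), -)` takes
left `Λ`-modules to left `ε(Λ)`-modules. -/
abbrev syzygyFiltered : Type u :=
  (Module.End (NakayamaAlgebra k c) (generatorModule k c))ᵐᵒᵖ

end NakayamaAlgebra

/-- `A'` is an `m`-fold covering of `A`: `A` is the Nakayama algebra with some Kupisch series `d`,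
and `A'` is the Nakayama algebra whose Kupisch series is `d` repeated `m` times. -/
def IsCovering (k : Type u) [Field k] (m : ℕ) [NeZero m] (A' A : Type u) [Ring A'] [Algebra k A']
    [Ring A] [Algebra k A] : Prop :=
  ∃ (r : ℕ) (_ : NeZero r) (d : ZMod r → ℕ), IsKupischSeries d ∧
    Nonempty (A ≃ₐ[k] NakayamaAlgebra k d) ∧
    Nonempty (A' ≃ₐ[k] NakayamaAlgebra k (repeatSeries m d))

/-!
Write `Λ` for the Nakayama algebra of `c` and `Λ'` for its `m`-fold covering.

**Homological part.**  Sending each vertex and each arrow of `Λ` to the sum of its preimages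
defines an algebra homomorphism `toCovering : Λ → Λ'`.  Restriction along it, the push-down, has
the pull-up functor `PullUp` as a left and as a right adjoint: at a vertex of the covering, the
pull-up of `M` is the component of `M` at the image of that vertex.  Both functors are exact, so
the pull-up preserves projective and injective modules; it sends `Λ` to `Λ'`
(`PullUp.regularEquiv`), and it preserves essential submodules, because these are the submodules
that contain all elements annihilated by the arrows (`isEssentialSubmodule_iff`).  Hence a minimal
injective resolution of `Λ` pulls up to one of `Λ'`, and the dominant dimension of `Λ'` is at least
that of `Λ`.  The push-down preserves and reflects projective modules, hence projective dimensions
(`PushDown.pdLT_iff`), and every simple `Λ`-module is a push-down, so the global dimensions agree.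
The missing inequality holds for every cyclic Nakayama algebra
(`dominantDimension_le_globalDimension`): if the global dimension is `d` and the terms
`I 0, …, I d` of the minimal injective resolution are projective, then dimension shifting shows that
the image of `I 0 → I 1` is projective, so that the algebra is self-injective; over a self-injective
algebra finitely generated modules of finite projective dimension are projective, but the simple
modules are not.

**Syzygy filtered algebras.**  The socle of `P_i` is the simple module at `i + c i - 1`, so the set
`𝒮'` consists of the vertices `i + c i`, and the set of `Λ'` is the preimage of the set of `Λ`.  For
any nonempty set `J` of vertices, the opposite endomorphism algebra of `⨁ P_j` over `j` in `J` is
generated by the paths between consecutive elements of `J`, and it is the Nakayama algebra of the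
series that counts composition factors in `J` (`endEquiv`).  A set of vertices and its preimage in
the covering have the same lift to the natural numbers, and with respect to the increasing
enumeration of this lift the two series are given by the same formula; only their periods differ,
by the factor `m`.  So the series of `Λ'` is that of `Λ`, repeated `m` times.
-/

/-! ### Paths in a Nakayama algebra -/

/-- The inequality `c i ≤ c (i + 1) + 1` of a Kupisch series, iterated along a path. -/
theorem le_add_of_kupisch {n : ℕ} {c : ZMod n → ℕ} (hc : ∀ i, c i ≤ c (i + 1) + 1)
    (i : ZMod n) (l : ℕ) : c i ≤ c (i + (l : ZMod n)) + l := by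
  induction l with
  | zero => simp
  | succ l ih =>
    have h := hc (i + (l : ZMod n))
    rw [add_assoc, ← Nat.cast_add_one] at h
    omega

namespace NakayamaAlgebra

section Paths

variable (k : Type u) [Field k] {n : ℕ} [NeZero n] (c : ZMod n → ℕ)

/-- The arrow `i → i + 1`, as an element of the Nakayama algebra. -/
noncomputable def α (i : ZMod n) : NakayamaAlgebra k c :=
  mk k c (FreeAlgebra.ι k (Gen.arrow i))

/-- The path of length `l` starting at `i`, as an element of the Nakayama algebra. -/
noncomputable def path (i : ZMod n) (l : ℕ) : NakayamaAlgebra k c :=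
  mk k c (freePath k i l)

theorem mk_eq_of_rel {x y : FreeAlgebra k (Gen n)} (h : Rel k c x y) : mk k c x = mk k c y :=
  RingQuot.mkAlgHom_rel k h

theorem e_mul_e_self (i : ZMod n) : e k c i * e k c i = e k c i := by
  simpa [e] using mk_eq_of_rel k c (Rel.idem i)

theorem e_mul_e_of_ne {i j : ZMod n} (h : i ≠ j) : e k c i * e k c j = 0 := by
  simpa [e] using mk_eq_of_rel k c (Rel.orth i j h)

theorem sum_e : ∑ i, e k c i = 1 := by
  simpa [e] using mk_eq_of_rel k c (Rel.sum_vertex)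

theorem α_mul_e (i : ZMod n) : α k c i * e k c i = α k c i := by
  simpa [e, α] using mk_eq_of_rel k c (Rel.source i)

theorem e_mul_α (i : ZMod n) : e k c (i + 1) * α k c i = α k c i := by
  simpa [e, α] using mk_eq_of_rel k c (Rel.target i)

theorem e_mul_e (i j : ZMod n) : e k c i * e k c j = if i = j then e k c j else 0 := by
  split_ifs with h
  · rw [h, e_mul_e_self]
  · exact e_mul_e_of_ne k c h

theorem path_zero (i : ZMod n) : path k c i 0 = e k c i := rfl

theorem path_succ (i : ZMod n) (l : ℕ) :
    path k c i (l + 1) = α k c (i + (l : ZMod n)) * path k c i l := by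
  simp [path, α, freePath]

theorem path_length (i : ZMod n) : path k c i (c i) = 0 := by
  simpa [path] using mk_eq_of_rel k c (Rel.zero i)

theorem path_eq_zero {i : ZMod n} {l : ℕ} (h : c i ≤ l) : path k c i l = 0 := by
  induction l, h using Nat.le_induction with
  | base => exact path_length k c i
  | succ l _ ih => rw [path_succ, ih, mul_zero]

theorem path_mul_e_self (i : ZMod n) (l : ℕ) : path k c i l * e k c i = path k c i l := by
  induction l with
  | zero => exact e_mul_e_self k c i
  | succ l ih => rw [path_succ, mul_assoc, ih]

theorem e_mul_path_self (i : ZMod n) (l : ℕ) :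
    e k c (i + (l : ZMod n)) * path k c i l = path k c i l := by
  cases l with
  | zero => simpa [path_zero] using e_mul_e_self k c i
  | succ l => rw [path_succ, ← mul_assoc, Nat.cast_succ, ← add_assoc, e_mul_α]

theorem e_mul_path (j i : ZMod n) (l : ℕ) :
    e k c j * path k c i l = if j = i + (l : ZMod n) then path k c i l else 0 := by
  rw [← e_mul_path_self k c i l, ← mul_assoc, e_mul_e]
  split_ifs
  · rfl
  · exact zero_mul _

theorem path_mul_e (j i : ZMod n) (l : ℕ) :
    path k c i l * e k c j = if i = j then path k c i l else 0 := by
  rw [← path_mul_e_self k c i l, mul_assoc, e_mul_e]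
  split_ifs with h
  · rw [h]
  · exact mul_zero _

theorem e_mul_arrow (j i : ZMod n) : e k c j * α k c i = if j = i + 1 then α k c i else 0 := by
  rw [← e_mul_α k c i, ← mul_assoc, e_mul_e]
  split_ifs
  · rfl
  · exact zero_mul _

theorem arrow_mul_e (i j : ZMod n) : α k c i * e k c j = if i = j then α k c i else 0 := by
  rw [← α_mul_e k c i, mul_assoc, e_mul_e]
  split_ifs with h
  · rw [h]
  · exact mul_zero _

theorem α_mul_path (j i : ZMod n) (l : ℕ) :
    α k c j * path k c i l = if j = i + (l : ZMod n) then path k c i (l + 1) else 0 := by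
  split_ifs with h
  · rw [h, path_succ]
  · rw [← α_mul_e, mul_assoc, e_mul_path, if_neg h, mul_zero]

theorem path_mul_path (i : ZMod n) (l l' : ℕ) :
    path k c (i + (l : ZMod n)) l' * path k c i l = path k c i (l + l') := by
  induction l' with
  | zero => exact e_mul_path_self k c i l
  | succ l' ih =>
    rw [path_succ, mul_assoc, ih, ← add_assoc, path_succ, Nat.cast_add, add_assoc]

variable {k c} in
/-- A property that holds for scalars, vertices and arrows and is stable under sums and products
holds for all elements. -/
@[elab_as_elim]
theorem induction {p : NakayamaAlgebra k c → Prop} (a : NakayamaAlgebra k c)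
    (scalar : ∀ r, p (algebraMap k _ r)) (vertex : ∀ i, p (e k c i)) (arrow : ∀ i, p (α k c i))
    (add : ∀ a b, p a → p b → p (a + b)) (mul : ∀ a b, p a → p b → p (a * b)) : p a := by
  obtain ⟨x, rfl⟩ := RingQuot.mkAlgHom_surjective k (Rel k c) a
  change p (mk k c x)
  induction x using FreeAlgebra.induction with
  | grade0 r => rw [AlgHom.commutes]; exact scalar r
  | grade1 g => cases g with
    | vertex i => exact vertex i
    | arrow i => exact arrow i
  | mul a b ha hb => rw [map_mul]; exact mul _ _ ha hb
  | add a b ha hb => rw [map_add]; exact add _ _ ha hb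

theorem span_path : Submodule.span k {a | ∃ i l, l < c i ∧ a = path k c i l} = ⊤ := by
  set W := Submodule.span k {a | ∃ i l, l < c i ∧ a = path k c i l} with hW
  have hpath : ∀ i l, path k c i l ∈ W := fun i l => by
    by_cases h : l < c i
    · exact Submodule.subset_span ⟨i, l, h, rfl⟩
    · rw [path_eq_zero k c (not_lt.1 h)]; exact W.zero_mem
  have key : ∀ a x : NakayamaAlgebra k c, x ∈ W → a * x ∈ W := by
    intro a
    induction a using NakayamaAlgebra.induction with
    | scalar r => intro x hx; rw [← Algebra.smul_def]; exact W.smul_mem r hx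
    | vertex j =>
      intro x hx
      induction hx using Submodule.span_induction with
      | mem x hx =>
        obtain ⟨i, l, -, rfl⟩ := hx
        rw [e_mul_path]; split_ifs
        · exact hpath _ _
        · exact W.zero_mem
      | zero => simp
      | add x y _ _ hx hy => rw [mul_add]; exact W.add_mem hx hy
      | smul r x _ hx => rw [mul_smul_comm]; exact W.smul_mem r hx
    | arrow j =>
      intro x hx
      induction hx using Submodule.span_induction with
      | mem x hx =>
        obtain ⟨i, l, -, rfl⟩ := hx
        rw [α_mul_path]; split_ifs
        · exact hpath _ _
        · exact W.zero_mem
      | zero => simp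
      | add x y _ _ hx hy => rw [mul_add]; exact W.add_mem hx hy
      | smul r x _ hx => rw [mul_smul_comm]; exact W.smul_mem r hx
    | add a b ha hb => intro x hx; rw [add_mul]; exact W.add_mem (ha x hx) (hb x hx)
    | mul a b ha hb => intro x hx; rw [mul_assoc]; exact ha _ (hb x hx)
  refine eq_top_iff.2 fun a _ => ?_
  rw [← mul_one a, ← sum_e]
  exact key a _ (W.sum_mem fun i _ => path_zero k c i ▸ hpath i 0)

instance : Module.Finite k (NakayamaAlgebra k c) := by
  rw [Module.finite_def, ← span_path k c]
  refine Submodule.fg_span ((Set.finite_range fun p : Σ i : ZMod n, Fin (c i) =>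
    path k c p.1 p.2).subset ?_)
  rintro a ⟨i, l, h, rfl⟩
  exact ⟨⟨i, ⟨l, h⟩⟩, rfl⟩

end Paths

section Lift

variable {k : Type u} [Field k] {n : ℕ} [NeZero n] {c : ZMod n → ℕ}

/-- The product of `A (i + l - 1), …, A i` and `E i`: the image of the path of length `l`
starting at `i` when vertices and arrows are sent to `E` and `A`. -/
def genPath {B : Type*} [Mul B] {n : ℕ} (E A : ZMod n → B) (i : ZMod n) : ℕ → B
  | 0 => E i
  | l + 1 => A (i + (l : ZMod n)) * genPath E A i l

variable (k c) in
/-- Elements of a `k`-algebra `B` that satisfy the defining relations of the Nakayama algebra. -/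
structure Realization (B : Type*) [Ring B] [Algebra k B] where
  E : ZMod n → B
  A : ZMod n → B
  idem : ∀ i, E i * E i = E i
  orth : ∀ i j, i ≠ j → E i * E j = 0
  sum_vertex : ∑ i, E i = 1
  source : ∀ i, A i * E i = A i
  target : ∀ i, E (i + 1) * A i = A i
  zero : ∀ i, genPath E A i (c i) = 0

namespace Realization

variable {B : Type*} [Ring B] [Algebra k B] (X : Realization k c B)

/-- The values of a realization on the generators. -/
def onGen : Gen n → B
  | Gen.vertex i => X.E i
  | Gen.arrow i => X.A i

theorem lift_freePath (i : ZMod n) (l : ℕ) :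
    FreeAlgebra.lift k X.onGen (freePath k i l) = genPath X.E X.A i l := by
  induction l with
  | zero => simp [freePath, genPath, onGen]
  | succ l ih => simp [freePath, genPath, onGen, ih]

/-- The algebra homomorphism given by a realization. -/
noncomputable def lift : NakayamaAlgebra k c →ₐ[k] B :=
  RingQuot.liftAlgHom k ⟨FreeAlgebra.lift k X.onGen, by
    intro x y h
    cases h with
    | idem i => simpa [onGen] using X.idem i
    | orth i j h => simpa [onGen] using X.orth i j h
    | sum_vertex => simpa [onGen] using X.sum_vertex
    | source i => simpa [onGen] using X.source i
    | target i => simpa [onGen] using X.target i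
    | zero i => rw [lift_freePath, X.zero, map_zero]⟩

theorem lift_mk (x : FreeAlgebra k (Gen n)) :
    X.lift (NakayamaAlgebra.mk k c x) = FreeAlgebra.lift k X.onGen x :=
  RingQuot.liftAlgHom_mkAlgHom_apply ..

@[simp] theorem lift_e (i : ZMod n) : X.lift (e k c i) = X.E i := by
  rw [e, lift_mk, FreeAlgebra.lift_ι_apply]; rfl

@[simp] theorem lift_α (i : ZMod n) : X.lift (α k c i) = X.A i := by
  rw [α, lift_mk, FreeAlgebra.lift_ι_apply]; rfl

theorem lift_path (i : ZMod n) (l : ℕ) : X.lift (path k c i l) = genPath X.E X.A i l := by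
  rw [path, lift_mk, lift_freePath]

end Realization

end Lift

end NakayamaAlgebra

/-! ### The path basis -/

namespace NakayamaAlgebra

section PathModule

variable (k : Type u) [Field k] {n : ℕ} (c : ZMod n → ℕ)

/-- The action of a generator on `(ZMod n × ℕ) →₀ k`, the space with basis the formal paths
`(i, l)` of length `l` starting at `i`: it sends a basis vector `p` with `q p` to `f p`, and the
other basis vectors to `0`. -/
noncomputable def pathOp (q : ZMod n × ℕ → Prop) [DecidablePred q]
    (f : ZMod n × ℕ → ZMod n × ℕ) : Module.End k ((ZMod n × ℕ) →₀ k) :=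
  Finsupp.lsum k fun p => if q p then Finsupp.lsingle (f p) else 0

variable {k c} in
theorem pathOp_single (q : ZMod n × ℕ → Prop) [DecidablePred q]
    (f : ZMod n × ℕ → ZMod n × ℕ) (p : ZMod n × ℕ) :
    pathOp k q f (Finsupp.single p 1) = if q p then Finsupp.single (f p) 1 else 0 := by
  rw [pathOp, Finsupp.lsum_single]
  split_ifs <;> simp

variable {k} in
theorem pathEnd_ext {f g : Module.End k ((ZMod n × ℕ) →₀ k)}
    (h : ∀ p, f (Finsupp.single p 1) = g (Finsupp.single p 1)) : f = g :=
  Finsupp.lhom_ext' fun p => LinearMap.ext_ring (h p)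

/-- In the representation where an arrow extends a formal path as long as the length stays below
the entry of `c` at the starting vertex, a path of length `l` extends a formal path by `l`. -/
theorem genPath_pathOp_single (i : ZMod n) (l : ℕ) (p : ZMod n × ℕ) :
    genPath (fun j => pathOp k (fun p => p.1 + (p.2 : ZMod n) = j) id)
      (fun j => pathOp k (fun p => p.1 + (p.2 : ZMod n) = j ∧ p.2 + 1 < c p.1)
        fun p => (p.1, p.2 + 1)) i l (Finsupp.single p 1) =
    if p.1 + (p.2 : ZMod n) = i ∧ (l = 0 ∨ p.2 + l < c p.1)
      then Finsupp.single (p.1, p.2 + l) 1 else 0 := by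
  induction l with
  | zero => simp [genPath, pathOp_single]
  | succ l ih =>
    rw [genPath, Module.End.mul_apply, ih]
    by_cases hp : p.1 + (p.2 : ZMod n) = i
    · subst hp
      by_cases h : p.2 + (l + 1) < c p.1
      · have h' : l = 0 ∨ p.2 + l < c p.1 := Or.inr (by omega)
        simp only [h', true_and, and_self, if_true, pathOp_single]
        rw [if_pos ⟨by push_cast; ring, by omega⟩, if_pos (Or.inr h)]
        rfl
      · have h1 : ¬ (p.2 + l + 1 < c p.1) := by omega
        rw [if_neg (c := _ ∧ (l + 1 = 0 ∨ _)) (by rintro ⟨-, h' | h'⟩ <;> omega)]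
        split_ifs
        · rw [pathOp_single, if_neg fun h' => h1 h'.2]
        · rw [map_zero]
    · simp [hp]

variable [NeZero n]

variable {c} in
/-- The regular representation of the Nakayama algebra on formal paths. -/
noncomputable def pathRealization (hc : IsKupischSeries c) :
    Realization k c (Module.End k ((ZMod n × ℕ) →₀ k)) where
  E j := pathOp k (fun p => p.1 + (p.2 : ZMod n) = j) id
  A j := pathOp k (fun p => p.1 + (p.2 : ZMod n) = j ∧ p.2 + 1 < c p.1) fun p => (p.1, p.2 + 1)
  idem i := pathEnd_ext fun p => by
    rw [Module.End.mul_apply, pathOp_single]; split_ifs with h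
    · simp [pathOp_single, h]
    · simp
  orth i j h := pathEnd_ext fun p => by
    rw [Module.End.mul_apply, pathOp_single]; split_ifs with h'
    · simp [pathOp_single, h', h.symm]
    · simp
  sum_vertex := pathEnd_ext fun p => by
    simp [LinearMap.sum_apply, pathOp_single]
  source i := pathEnd_ext fun p => by
    rw [Module.End.mul_apply, pathOp_single]; split_ifs with h'
    · simp
    · simp [pathOp_single, h']
  target i := pathEnd_ext fun p => by
    rw [Module.End.mul_apply, pathOp_single]; split_ifs with h'
    · simp [pathOp_single, ← h'.1, add_assoc]
    · simp
  zero i := pathEnd_ext fun p => by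
    rw [genPath_pathOp_single, if_neg, LinearMap.zero_apply]
    rintro ⟨rfl, h⟩
    have h1 := hc.1 (p.1 + (p.2 : ZMod n))
    have h2 := le_add_of_kupisch hc.2 p.1 p.2
    omega

variable {k c}

theorem lift_path_single (hc : IsKupischSeries c) (i : ZMod n) {l : ℕ} (hl : l < c i) :
    (pathRealization k hc).lift (path k c i l) (∑ j, Finsupp.single (j, 0) 1) =
      Finsupp.single (i, l) 1 := by
  rw [Realization.lift_path, map_sum, Finset.sum_eq_single i]
  · refine (genPath_pathOp_single k c i l (i, 0)).trans ?_
    simp [hl]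
  · intro j _ hj
    refine (genPath_pathOp_single k c i l (j, 0)).trans ?_
    simp [hj]
  · simp

/-- The coordinates of an element with respect to the paths: a `k`-linear map to the space with
basis the formal paths. -/
noncomputable def coord (hc : IsKupischSeries c) :
    NakayamaAlgebra k c →ₗ[k] ((ZMod n × ℕ) →₀ k) :=
  LinearMap.applyₗ (∑ j, Finsupp.single (j, 0) (1 : k)) ∘ₗ
    (pathRealization k hc).lift.toLinearMap

theorem coord_path (hc : IsKupischSeries c) (i : ZMod n) {l : ℕ} (hl : l < c i) :
    coord hc (path k c i l) = Finsupp.single (i, l) 1 :=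
  lift_path_single hc i hl

theorem path_ne_zero (hc : IsKupischSeries c) (i : ZMod n) {l : ℕ} (hl : l < c i) :
    path k c i l ≠ 0 := fun h => by
  have := coord_path (k := k) hc i hl
  rw [h, map_zero] at this
  exact one_ne_zero (α := k) (by simpa using (DFunLike.congr_fun this (i, l)).symm)

/-- Every element of `Λ e_i` is a linear combination of the paths starting at `i`. -/
theorem mul_e_eq_sum (a : NakayamaAlgebra k c) (i : ZMod n) :
    ∃ f : ℕ → k, a * e k c i = ∑ l ∈ Finset.range (c i), f l • path k c i l := by
  have ha : a ∈ Submodule.span k {a | ∃ i l, l < c i ∧ a = path k c i l} := by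
    rw [span_path]; trivial
  induction ha using Submodule.span_induction with
  | mem x hx =>
    obtain ⟨j, l, hl, rfl⟩ := hx
    rw [path_mul_e]
    split_ifs with h
    · subst h
      refine ⟨Pi.single l 1, ?_⟩
      rw [Finset.sum_eq_single l]
      · simp
      · intro b _ hb; simp [hb]
      · intro h; exact absurd (Finset.mem_range.2 hl) h
    · exact ⟨0, by simp⟩
  | zero => exact ⟨0, by simp⟩
  | add x y _ _ hx hy =>
    obtain ⟨f, hf⟩ := hx
    obtain ⟨g, hg⟩ := hy
    exact ⟨f + g, by simp [add_mul, hf, hg, add_smul, Finset.sum_add_distrib]⟩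
  | smul r x _ hx =>
    obtain ⟨f, hf⟩ := hx
    exact ⟨r • f, by simp [hf, Finset.smul_sum, mul_smul]⟩

end PathModule

end NakayamaAlgebra

/-! ### Pull-up and push-down along a covering -/

namespace NakayamaAlgebra

section LinearMaps

variable {k : Type u} [Field k] {n : ℕ} [NeZero n] {c : ZMod n → ℕ}

/-- An additive map that commutes with scalars, vertices and arrows is linear over the Nakayama
algebra. -/
def linearOfGenerators {M N : Type*} [AddCommGroup M] [AddCommGroup N]
    [Module (NakayamaAlgebra k c) M] [Module (NakayamaAlgebra k c) N] (f : M →+ N)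
    (hs : ∀ (r : k) (x : M),
      f (algebraMap k (NakayamaAlgebra k c) r • x) = algebraMap k (NakayamaAlgebra k c) r • f x)
    (he : ∀ i x, f (e k c i • x) = e k c i • f x)
    (hα : ∀ i x, f (α k c i • x) = α k c i • f x) : M →ₗ[NakayamaAlgebra k c] N where
  toFun := f
  map_add' := f.map_add
  map_smul' a := by
    induction a using NakayamaAlgebra.induction with
    | scalar r => exact hs r
    | vertex i => exact he i
    | arrow i => exact hα i
    | add a b ha hb => intro x; simp_all [add_smul]
    | mul a b ha hb => intro x; simp_all [mul_smul]

theorem sum_e_smul {M : Type*} [AddCommGroup M] [Module (NakayamaAlgebra k c) M] (x : M) :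
    ∑ j, e k c j • x = x := by
  rw [← Finset.sum_smul, sum_e, one_smul]

end LinearMaps

section Covering

variable (k : Type u) [Field k] {n : ℕ} (c : ZMod n → ℕ) (m : ℕ)

/-- The projection from the vertices of the `m`-fold covering. -/
def proj (n m : ℕ) : ZMod (m * n) →+* ZMod n := ZMod.castHom (dvd_mul_left n m) (ZMod n)

theorem repeatSeries_apply (i : ZMod (m * n)) : repeatSeries m c i = c (proj n m i) := rfl

theorem proj_surjective : Function.Surjective (proj n m) := ZMod.castHom_surjective _

variable {c} in
theorem isKupischSeries_repeatSeries (hc : IsKupischSeries c) :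
    IsKupischSeries (repeatSeries m c) :=
  ⟨fun i => hc.1 _, fun i => by
    have := hc.2 (proj n m i)
    rw [repeatSeries_apply, repeatSeries_apply, map_add, map_one]; exact this⟩

variable [NeZero n] [NeZero m]

open Classical in
theorem genPath_fiber (i : ZMod n) (l : ℕ) :
    genPath (fun i => ∑ j with proj n m j = i, e k (repeatSeries m c) j)
      (fun i => ∑ j with proj n m j = i, α k (repeatSeries m c) j) i l =
    ∑ j with proj n m j = i, path k (repeatSeries m c) j l := by
  induction l with
  | zero => rfl
  | succ l ih =>
    rw [genPath, ih, Finset.sum_mul_sum, Finset.sum_comm]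
    refine Finset.sum_congr rfl fun b hb => ?_
    simp only [α_mul_path]
    rw [Finset.sum_ite_eq', if_pos]
    simp only [Finset.mem_filter_univ] at hb ⊢
    rw [map_add, map_natCast, hb]

open Classical in
/-- The elements of the `m`-fold covering that the push-down functor uses: the sum of the vertices,
respectively of the arrows, in a fibre. -/
noncomputable def fiberRealization :
    Realization k c (NakayamaAlgebra k (repeatSeries m c)) where
  E i := ∑ j with proj n m j = i, e k _ j
  A i := ∑ j with proj n m j = i, α k _ j
  idem i := by
    rw [Finset.sum_mul_sum]
    refine Finset.sum_congr rfl fun b hb => ?_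
    simp only [e_mul_e]
    rw [Finset.sum_ite_eq, if_pos hb]
  orth i j h := by
    rw [Finset.sum_mul_sum]
    refine Finset.sum_eq_zero fun a ha => Finset.sum_eq_zero fun b hb => ?_
    refine e_mul_e_of_ne _ _ fun hab => h ?_
    simp only [Finset.mem_filter_univ] at ha hb
    rw [← ha, ← hb, hab]
  sum_vertex := by
    rw [Finset.sum_fiberwise, sum_e]
  source i := by
    have h := genPath_fiber k c m i 1
    simp only [genPath, path_succ, path_zero, Nat.cast_zero, add_zero, α_mul_e] at h
    exact h
  target i := by
    rw [Finset.sum_mul_sum, Finset.sum_comm]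
    refine Finset.sum_congr rfl fun b hb => ?_
    simp only [e_mul_arrow]
    rw [Finset.sum_ite_eq', if_pos]
    simp only [Finset.mem_filter_univ] at hb ⊢
    rw [map_add, map_one, hb]
  zero i := by
    rw [genPath_fiber]
    refine Finset.sum_eq_zero fun j hj => path_eq_zero k _ ?_
    rw [repeatSeries_apply, (Finset.mem_filter_univ j).1 hj]

/-- The algebra homomorphism from `Λ` to its `m`-fold covering, sending a vertex or an arrow to the
sum of its preimages.  Restriction along it is the push-down functor. -/
noncomputable def toCovering : NakayamaAlgebra k c →ₐ[k] NakayamaAlgebra k (repeatSeries m c) :=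
  (fiberRealization k c m).lift

open Classical in
theorem toCovering_e_mul_e (i : ZMod n) (j : ZMod (m * n)) :
    toCovering k c m (e k c i) * e k _ j = if proj n m j = i then e k _ j else 0 := by
  rw [toCovering, Realization.lift_e]
  simp only [fiberRealization, Finset.sum_mul, e_mul_e]
  rw [Finset.sum_ite_eq']
  simp

open Classical in
theorem e_mul_toCovering_e (i : ZMod n) (j : ZMod (m * n)) :
    e k _ j * toCovering k c m (e k c i) = if proj n m j = i then e k _ j else 0 := by
  rw [toCovering, Realization.lift_e]
  have h : ∀ x, e k (repeatSeries m c) j * e k _ x = if j = x then e k _ j else 0 := fun x => by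
    rw [e_mul_e]; split_ifs with h <;> simp [h]
  simp only [fiberRealization, Finset.mul_sum, h]
  rw [Finset.sum_ite_eq]
  simp

open Classical in
theorem toCovering_α_mul_e (i : ZMod n) (j : ZMod (m * n)) :
    toCovering k c m (α k c i) * e k _ j = if proj n m j = i then α k _ j else 0 := by
  rw [toCovering, Realization.lift_α]
  have h : ∀ x, α k (repeatSeries m c) x * e k _ j = if x = j then α k _ j else 0 := fun x => by
    rw [arrow_mul_e]; split_ifs with h <;> simp [h]
  simp only [fiberRealization, Finset.sum_mul, h]
  rw [Finset.sum_ite_eq']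
  simp

theorem e_mul_toCovering_α_succ (j : ZMod (m * n)) :
    e k _ (j + 1) * toCovering k c m (α k c (proj n m j)) = α k _ j := by
  classical
  rw [toCovering, Realization.lift_α]
  simp only [fiberRealization, Finset.mul_sum, e_mul_arrow, add_left_inj]
  rw [Finset.sum_ite_eq]
  simp

end Covering

section PullUp

variable (k : Type u) [Field k] {n : ℕ} [NeZero n] (c : ZMod n → ℕ) (m : ℕ)
variable (M : Type u) [AddCommGroup M] [Module k M] [Module (NakayamaAlgebra k c) M]
  [IsScalarTower k (NakayamaAlgebra k c) M]

/-- The underlying space of the pull-up of a `Λ`-module `M` to the `m`-fold covering: at a vertex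
`j` it is the component of `M` at the image of `j`. -/
def pullUpSpace : Submodule k (ZMod (m * n) → M) where
  carrier := {x | ∀ j, e k c (proj n m j) • x j = x j}
  add_mem' hx hy j := by rw [Pi.add_apply, smul_add, hx j, hy j]
  zero_mem' j := by simp
  smul_mem' r x hx j := by rw [Pi.smul_apply, smul_comm, hx j]

/-- The pull-up of a `Λ`-module to the `m`-fold covering of `Λ`. -/
def PullUp : Type u := pullUpSpace k c m M

noncomputable instance : AddCommGroup (PullUp k c m M) :=
  inferInstanceAs (AddCommGroup (pullUpSpace k c m M))

noncomputable instance : Module k (PullUp k c m M) :=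
  inferInstanceAs (Module k (pullUpSpace k c m M))

variable {k c m M}

namespace PullUp

/-- The component of an element of the pull-up at a vertex. -/
def comp (x : PullUp k c m M) (j : ZMod (m * n)) : M := x.1 j

@[ext] theorem ext {x y : PullUp k c m M} (h : ∀ j, x.comp j = y.comp j) : x = y :=
  Subtype.ext (funext h)

/-- An element of the pull-up given by its components. -/
def ofComp (x : ZMod (m * n) → M) (hx : ∀ j, e k c (proj n m j) • x j = x j) :
    PullUp k c m M := ⟨x, hx⟩

@[simp] theorem comp_ofComp (x : ZMod (m * n) → M) (hx : ∀ j, e k c (proj n m j) • x j = x j)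
    (j : ZMod (m * n)) : (ofComp x hx).comp j = x j := rfl

theorem e_smul_comp (x : PullUp k c m M) (j : ZMod (m * n)) :
    e k c (proj n m j) • x.comp j = x.comp j := x.2 j

@[simp] theorem comp_add (x y : PullUp k c m M) (j : ZMod (m * n)) :
    (x + y).comp j = x.comp j + y.comp j := rfl

@[simp] theorem comp_zero (j : ZMod (m * n)) : (0 : PullUp k c m M).comp j = 0 := rfl

@[simp] theorem comp_ksmul (r : k) (x : PullUp k c m M) (j : ZMod (m * n)) :
    (r • x).comp j = r • x.comp j := rfl

@[simp] theorem comp_sum {ι : Type*} (s : Finset ι) (f : ι → PullUp k c m M)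
    (j : ZMod (m * n)) : (∑ i ∈ s, f i).comp j = ∑ i ∈ s, (f i).comp j :=
  map_sum (⟨⟨fun x => x.comp j, rfl⟩, fun _ _ => rfl⟩ : PullUp k c m M →+ M) f s

variable (k c m M) in
/-- The operator that multiplies the component at `t` by `a` and places the result at `s`. -/
noncomputable def op (s t : ZMod (m * n)) (a : NakayamaAlgebra k c) (ha : e k c (proj n m s) * a = a) :
    Module.End k (PullUp k c m M) where
  toFun x := ofComp (fun j => if j = s then a • x.comp t else 0) fun j => by
    split_ifs with h
    · rw [h, ← mul_smul, ha]
    · exact smul_zero _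
  map_add' x y := by ext j; by_cases h : j = s <;> simp [h]
  map_smul' r x := by
    ext j
    change (if j = s then a • r • x.comp t else 0) = r • if j = s then a • x.comp t else 0
    split_ifs
    · rw [smul_comm]
    · rw [smul_zero]

theorem comp_op (s t : ZMod (m * n)) (a : NakayamaAlgebra k c)
    (ha : e k c (proj n m s) * a = a) (x : PullUp k c m M) (j : ZMod (m * n)) :
    (op k c m M s t a ha x).comp j = if j = s then a • x.comp t else 0 := rfl

theorem op_mul_op (s t u : ZMod (m * n)) (a b : NakayamaAlgebra k c)
    (ha : e k c (proj n m s) * a = a) (hb : e k c (proj n m t) * b = b)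
    (hab : e k c (proj n m s) * (a * b) = a * b) :
    op k c m M s t a ha * op k c m M t u b hb = op k c m M s u (a * b) hab := by
  ext x j
  simp [comp_op, mul_smul]

theorem op_congr {s s' t t' : ZMod (m * n)} {a a' : NakayamaAlgebra k c} (hs : s = s') (ht : t = t')
    (h : a = a') (ha : e k c (proj n m s) * a = a) (ha' : e k c (proj n m s') * a' = a') :
    op k c m M s t a ha = op k c m M s' t' a' ha' := by
  subst h; subst hs; subst ht; rfl

theorem e_proj_mul_α (j : ZMod (m * n)) :
    e k c (proj n m (j + 1)) * α k c (proj n m j) = α k c (proj n m j) := by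
  rw [map_add, map_one, e_mul_α]

theorem e_proj_mul_path (j : ZMod (m * n)) (l : ℕ) :
    e k c (proj n m (j + (l : ZMod (m * n)))) * path k c (proj n m j) l =
      path k c (proj n m j) l := by
  rw [map_add, map_natCast, e_mul_path_self]

theorem genPath_op (j : ZMod (m * n)) (l : ℕ) :
    genPath (fun j => op k c m M j j (e k c (proj n m j)) (e_mul_e_self k c _))
      (fun j => op k c m M (j + 1) j (α k c (proj n m j)) (e_proj_mul_α j)) j l =
    op k c m M (j + (l : ZMod (m * n))) j (path k c (proj n m j) l) (e_proj_mul_path j l) := by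
  induction l with
  | zero => exact op_congr (by simp) rfl rfl (e_mul_e_self k c _) _
  | succ l ih =>
    rw [genPath, ih, op_mul_op]
    · refine op_congr (by push_cast; ring) rfl ?_ _ _
      rw [path_succ, map_add, map_natCast]
    · rw [← mul_assoc, e_proj_mul_α]

variable [NeZero m]

variable (k c m M) in
/-- The action of the vertices and arrows of the covering on the pull-up. -/
noncomputable def realization :
    Realization k (repeatSeries m c) (Module.End k (PullUp k c m M)) where
  E j := op k c m M j j (e k c (proj n m j)) (e_mul_e_self k c _)
  A j := op k c m M (j + 1) j (α k c (proj n m j)) (e_proj_mul_α j)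
  idem j := by
    rw [op_mul_op]
    · exact op_congr rfl rfl (e_mul_e_self k c _) _ _
    · simp only [e_mul_e_self]
  orth i j h := by ext x a; simp [comp_op, h]
  sum_vertex := by ext x j; simp [comp_op, LinearMap.sum_apply, e_smul_comp]
  source j := by
    rw [op_mul_op]
    · exact op_congr rfl rfl (α_mul_e k c _) _ _
    · rw [α_mul_e, e_proj_mul_α]
  target j := by
    rw [op_mul_op]
    · exact op_congr rfl rfl (e_proj_mul_α j) _ _
    · rw [e_proj_mul_α, e_proj_mul_α]
  zero j := by
    rw [genPath_op]
    ext x a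
    rw [comp_op, repeatSeries_apply, path_length]
    simp

noncomputable instance : Module (NakayamaAlgebra k (repeatSeries m c)) (PullUp k c m M) :=
  Module.compHom _ (realization k c m M).lift.toRingHom

theorem smul_def (a : NakayamaAlgebra k (repeatSeries m c)) (x : PullUp k c m M) :
    a • x = (realization k c m M).lift a x := rfl

theorem comp_e_smul (i j : ZMod (m * n)) (x : PullUp k c m M) :
    (e k (repeatSeries m c) i • x).comp j = if j = i then x.comp j else 0 := by
  rw [smul_def, Realization.lift_e]
  refine (comp_op i i _ (e_mul_e_self k c _) x j).trans ?_
  split_ifs with h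
  · rw [h, e_smul_comp]
  · rfl

theorem comp_α_smul (i j : ZMod (m * n)) (x : PullUp k c m M) :
    (α k (repeatSeries m c) i • x).comp j =
      if j = i + 1 then α k c (proj n m i) • x.comp i else 0 := by
  rw [smul_def, Realization.lift_α]
  exact comp_op _ _ _ (e_proj_mul_α i) x j

theorem algebraMap_smul (r : k) (x : PullUp k c m M) :
    algebraMap k (NakayamaAlgebra k (repeatSeries m c)) r • x = r • x := by
  rw [smul_def, AlgHom.commutes]; rfl

theorem comp_algebraMap_smul (r : k) (x : PullUp k c m M) (j : ZMod (m * n)) :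
    (algebraMap k (NakayamaAlgebra k (repeatSeries m c)) r • x).comp j =
      algebraMap k (NakayamaAlgebra k c) r • x.comp j := by
  rw [algebraMap_smul, comp_ksmul, _root_.algebraMap_smul]

end PullUp

end PullUp

section Adjunctions

variable {k : Type u} [Field k] {n : ℕ} [NeZero n] {c : ZMod n → ℕ} {m : ℕ} [NeZero m]
variable {M M' : Type u} [AddCommGroup M] [Module k M] [Module (NakayamaAlgebra k c) M]
  [IsScalarTower k (NakayamaAlgebra k c) M] [AddCommGroup M'] [Module k M']
  [Module (NakayamaAlgebra k c) M'] [IsScalarTower k (NakayamaAlgebra k c) M']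
  {N : Type u} [AddCommGroup N] [Module (NakayamaAlgebra k (repeatSeries m c)) N]

namespace PullUp

variable (k c m M) in
/-- The unit of the adjunction between the pull-up and the push-down. -/
noncomputable def unit : M →+ PullUp k c m M where
  toFun x := ofComp (fun j => e k c (proj n m j) • x) fun j => by rw [← mul_smul, e_mul_e_self]
  map_zero' := by ext j; simp
  map_add' x y := by ext j; simp

omit [NeZero m] in
@[simp] theorem comp_unit (x : M) (j : ZMod (m * n)) :
    (unit k c m M x).comp j = e k c (proj n m j) • x := rfl

end PullUp

theorem e_smul_toCovering_e_smul (j : ZMod (m * n)) (y : N) :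
    toCovering k c m (e k c (proj n m j)) • e k (repeatSeries m c) j • y =
      e k (repeatSeries m c) j • y := by
  classical rw [← mul_smul, toCovering_e_mul_e, if_pos rfl]

namespace PullUp

/-- The functoriality of the pull-up. -/
noncomputable def map (f : M →ₗ[NakayamaAlgebra k c] M') :
    PullUp k c m M →ₗ[NakayamaAlgebra k (repeatSeries m c)] PullUp k c m M' :=
  linearOfGenerators
    { toFun := fun x => ofComp (fun j => f (x.comp j)) fun j => by
        rw [← map_smul, e_smul_comp]
      map_zero' := by ext j; simp
      map_add' := fun x y => by ext j; simp }
    (fun r x => by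
      ext j
      rw [comp_algebraMap_smul]
      exact (congrArg f (comp_algebraMap_smul r x j)).trans (map_smul f _ _))
    (fun i x => by
      ext j
      rw [comp_e_smul]
      refine (congrArg f (comp_e_smul i j x)).trans ?_
      split_ifs <;> simp)
    (fun i x => by
      ext j
      rw [comp_α_smul]
      refine (congrArg f (comp_α_smul i j x)).trans ?_
      split_ifs <;> simp)

@[simp] theorem comp_map (f : M →ₗ[NakayamaAlgebra k c] M') (x : PullUp k c m M)
    (j : ZMod (m * n)) : (map f x).comp j = f (x.comp j) := rfl

theorem map_injective {f : M →ₗ[NakayamaAlgebra k c] M'} (hf : Function.Injective f) :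
    Function.Injective (map f : PullUp k c m M → PullUp k c m M') := fun x y h => by
  ext j
  exact hf (congrArg (fun z : PullUp k c m M' => z.comp j) h)

theorem map_surjective {f : M →ₗ[NakayamaAlgebra k c] M'} (hf : Function.Surjective f) :
    Function.Surjective (map f : PullUp k c m M → PullUp k c m M') := fun y => by
  choose g hg using hf
  refine ⟨ofComp (fun j => e k c (proj n m j) • g (y.comp j)) fun j => ?_, ?_⟩
  · rw [← mul_smul, e_mul_e_self]
  · ext j
    rw [comp_map, comp_ofComp, map_smul, hg, e_smul_comp]

theorem map_exact {M'' : Type u} [AddCommGroup M''] [Module k M'']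
    [Module (NakayamaAlgebra k c) M''] [IsScalarTower k (NakayamaAlgebra k c) M'']
    {f : M →ₗ[NakayamaAlgebra k c] M'} {g : M' →ₗ[NakayamaAlgebra k c] M''}
    (h : Function.Exact f g) :
    Function.Exact (map f : PullUp k c m M → PullUp k c m M') (map g) := fun y => by
  constructor
  · intro hy
    have : ∀ j, ∃ x, f x = y.comp j := fun j =>
      (h _).1 (congrArg (fun z : PullUp k c m M'' => z.comp j) hy)
    choose x hx using this
    refine ⟨ofComp (fun j => e k c (proj n m j) • x j) fun j => ?_, ?_⟩
    · rw [← mul_smul, e_mul_e_self]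
    · ext j
      rw [comp_map, comp_ofComp, map_smul, hx, e_smul_comp]
  · rintro ⟨x, rfl⟩
    ext j
    exact (h _).2 ⟨_, rfl⟩

/-- The pull-up is right adjoint to the push-down: a `Λ`-linear map from the push-down of `N` to
`M` gives a linear map from `N` to the pull-up of `M`. -/
noncomputable def lift (g : N →+ M) (hg : ∀ a y, g (toCovering k c m a • y) = a • g y) :
    N →ₗ[NakayamaAlgebra k (repeatSeries m c)] PullUp k c m M :=
  linearOfGenerators
    { toFun := fun y => ofComp (fun j => g (e k _ j • y)) fun j => by
        rw [← hg, e_smul_toCovering_e_smul]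
      map_zero' := by ext j; simp
      map_add' := fun x y => by ext j; simp }
    (fun r x => by
      ext j
      rw [comp_algebraMap_smul]
      refine Eq.trans ?_ (hg _ _)
      change g _ = g _
      rw [AlgHom.commutes, ← mul_smul, ← Algebra.commutes, mul_smul])
    (fun i x => by
      ext j
      rw [comp_e_smul]
      change g _ = ite _ (g _) _
      rw [← mul_smul, e_mul_e]
      split_ifs with h
      · rw [h]
      · rw [zero_smul, map_zero])
    (fun i x => by
      ext j
      rw [comp_α_smul]
      change g _ = ite _ (_ • g _) _
      rw [← mul_smul, e_mul_arrow, ← hg, ← mul_smul]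
      classical
      rw [toCovering_α_mul_e, if_pos rfl]
      split_ifs
      · rfl
      · rw [zero_smul, map_zero])

@[simp] theorem comp_lift (g : N →+ M) (hg : ∀ a y, g (toCovering k c m a • y) = a • g y) (y : N)
    (j : ZMod (m * n)) : (lift g hg y).comp j = g (e k (repeatSeries m c) j • y) := rfl

/-- The pull-up is also left adjoint to the push-down: a `Λ`-linear map from `M` to the push-down
of `N` gives a linear map from the pull-up of `M` to `N`. -/
noncomputable def desc (g : M →+ N) (hg : ∀ a x, g (a • x) = toCovering k c m a • g x) :
    PullUp k c m M →ₗ[NakayamaAlgebra k (repeatSeries m c)] N :=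
  linearOfGenerators
    { toFun := fun x => ∑ j, e k (repeatSeries m c) j • g (x.comp j)
      map_zero' := by simp
      map_add' := fun x y => by simp [Finset.sum_add_distrib] }
    (fun r x => by
      change ∑ j, _ = _ • ∑ j, _
      rw [Finset.smul_sum]
      refine Finset.sum_congr rfl fun j _ => ?_
      rw [comp_algebraMap_smul, hg, AlgHom.commutes, ← mul_smul, ← Algebra.commutes, mul_smul])
    (fun i x => by
      change ∑ j, _ = _ • ∑ j, _
      rw [Finset.smul_sum]
      refine Finset.sum_congr rfl fun j _ => ?_
      rw [comp_e_smul, ← mul_smul, e_mul_e]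
      by_cases h : j = i
      · rw [if_pos h, if_pos h.symm]
      · rw [if_neg h, if_neg (Ne.symm h), map_zero, smul_zero, zero_smul])
    (fun i x => by
      change ∑ j, _ = _ • ∑ j, _
      rw [Finset.smul_sum]
      simp only [← mul_smul, arrow_mul_e, comp_α_smul, ite_smul, zero_smul]
      rw [Finset.sum_ite_eq, if_pos (Finset.mem_univ _), Finset.sum_eq_single (i + 1)]
      · rw [if_pos rfl, hg, ← mul_smul, e_mul_toCovering_α_succ]
      · intro j _ hj
        rw [if_neg hj, map_zero, smul_zero]
      · exact fun h => absurd (Finset.mem_univ _) h)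

theorem desc_apply (g : M →+ N) (hg : ∀ a x, g (a • x) = toCovering k c m a • g x)
    (x : PullUp k c m M) : desc g hg x = ∑ j, e k (repeatSeries m c) j • g (x.comp j) := rfl

open Classical in
theorem comp_toCovering_e_smul (i : ZMod n) (x : PullUp k c m M) (j : ZMod (m * n)) :
    (toCovering k c m (e k c i) • x).comp j = if proj n m j = i then x.comp j else 0 := by
  rw [toCovering, Realization.lift_e]
  simp only [fiberRealization, Finset.sum_smul, comp_sum, comp_e_smul]
  rw [Finset.sum_ite_eq]
  simp

open Classical in
theorem comp_toCovering_α_smul (i : ZMod n) (x : PullUp k c m M) (j : ZMod (m * n)) :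
    (toCovering k c m (α k c i) • x).comp j =
      if proj n m j = i + 1 then α k c i • x.comp (j - 1) else 0 := by
  rw [toCovering, Realization.lift_α]
  simp only [fiberRealization, Finset.sum_smul, comp_sum, comp_α_smul, ← sub_eq_iff_eq_add]
  rw [Finset.sum_ite_eq]
  simp only [Finset.mem_filter_univ, map_sub, map_one, sub_eq_iff_eq_add]
  split_ifs with h
  · rw [h, add_sub_cancel_right]
  · rfl

theorem unit_smul (a : NakayamaAlgebra k c) (x : M) :
    unit k c m M (a • x) = toCovering k c m a • unit k c m M x := by
  classical
  induction a using NakayamaAlgebra.induction generalizing x with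
  | scalar r =>
    ext j
    rw [AlgHom.commutes, comp_algebraMap_smul, comp_unit, comp_unit, ← mul_smul,
      ← Algebra.commutes, mul_smul]
  | vertex i =>
    ext j
    rw [comp_toCovering_e_smul, comp_unit, comp_unit, ← mul_smul, e_mul_e]
    split_ifs with h
    · rw [h]
    · exact zero_smul _ _
  | arrow i =>
    ext j
    rw [comp_toCovering_α_smul, comp_unit, comp_unit, ← mul_smul, e_mul_arrow]
    split_ifs with h
    · rw [map_sub, h, map_one, add_sub_cancel_right, ← mul_smul, α_mul_e]
    · exact zero_smul _ _
  | add a b ha hb => rw [add_smul, map_add, map_add, add_smul, ha, hb]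
  | mul a b ha hb => rw [mul_smul, ha, hb, map_mul, mul_smul]

variable (k c m M) in
/-- The counit of the adjunction between the push-down and the pull-up. -/
noncomputable def counit : PullUp k c m M →+ M where
  toFun x := ∑ j, x.comp j
  map_zero' := by simp
  map_add' x y := by simp [Finset.sum_add_distrib]

theorem counit_apply (x : PullUp k c m M) : counit k c m M x = ∑ j, x.comp j := rfl

theorem counit_smul (a : NakayamaAlgebra k c) (x : PullUp k c m M) :
    counit k c m M (toCovering k c m a • x) = a • counit k c m M x := by
  classical
  induction a using NakayamaAlgebra.induction generalizing x with
  | scalar r =>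
    rw [AlgHom.commutes, counit_apply, counit_apply, Finset.smul_sum]
    exact Finset.sum_congr rfl fun j _ => comp_algebraMap_smul r x j
  | vertex i =>
    rw [counit_apply, counit_apply, Finset.smul_sum]
    refine Finset.sum_congr rfl fun j _ => ?_
    rw [comp_toCovering_e_smul, ← e_smul_comp, ← mul_smul, e_mul_e]
    by_cases h : proj n m j = i
    · rw [if_pos h, if_pos h.symm]
    · rw [if_neg h, if_neg (Ne.symm h), zero_smul]
  | arrow i =>
    rw [counit_apply, counit_apply, Finset.smul_sum,
      ← Equiv.sum_comp (Equiv.addRight (1 : ZMod (m * n)))]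
    refine Finset.sum_congr rfl fun j _ => ?_
    rw [comp_toCovering_α_smul, Equiv.coe_addRight, add_sub_cancel_right, map_add, map_one,
      ← e_smul_comp, ← mul_smul, arrow_mul_e]
    by_cases h : proj n m j = i
    · rw [if_pos (congrArg (· + 1) h), if_pos h.symm]
    · rw [if_neg fun h' => h (add_right_cancel h'), if_neg (Ne.symm h), zero_smul]
  | add a b ha hb => rw [add_smul, map_add, add_smul, map_add, ha, hb]
  | mul a b ha hb => rw [mul_smul, map_mul, mul_smul, ha, hb]

theorem e_smul_unit_comp (j : ZMod (m * n)) (x : PullUp k c m M) :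
    e k (repeatSeries m c) j • unit k c m M (x.comp j) = e k (repeatSeries m c) j • x := by
  ext i
  rw [comp_e_smul, comp_e_smul]
  split_ifs with h
  · rw [comp_unit, h, e_smul_comp]
  · rfl

variable (k c m) in
/-- The pull-up of the regular module is the regular module of the covering. -/
noncomputable def regularEquiv : NakayamaAlgebra k (repeatSeries m c)
    ≃ₗ[NakayamaAlgebra k (repeatSeries m c)] PullUp k c m (NakayamaAlgebra k c) :=
  LinearEquiv.ofLinearMap
    (LinearMap.toSpanSingleton _ _ (unit k c m _ 1))
    (desc (toCovering k c m : NakayamaAlgebra k c →+ NakayamaAlgebra k (repeatSeries m c))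
      fun a x => by rw [smul_eq_mul, smul_eq_mul]; exact map_mul (toCovering k c m) a x)
    (by
      ext1 x
      rw [LinearMap.comp_apply, LinearMap.toSpanSingleton_apply, desc_apply, Finset.sum_smul]
      refine (Finset.sum_congr rfl fun j _ => ?_).trans (sum_e_smul (k := k) (c := repeatSeries m c) x)
      rw [smul_eq_mul, mul_smul]
      refine (congrArg _ (unit_smul (x.comp j) (1 : NakayamaAlgebra k c)).symm).trans ?_
      rw [smul_eq_mul, mul_one, e_smul_unit_comp])
    (by
      refine LinearMap.ext_ring ?_
      rw [LinearMap.comp_apply, LinearMap.toSpanSingleton_apply, one_smul, desc_apply]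
      refine (Finset.sum_congr rfl fun j _ => ?_).trans (sum_e k (repeatSeries m c))
      classical
      rw [comp_unit, smul_eq_mul]
      refine (congrArg (fun a => _ * toCovering k c m a) (mul_one _)).trans ?_
      exact (e_mul_toCovering_e k c m _ j).trans (if_pos rfl))

/-- The pull-up preserves injective modules, being right adjoint to an exact functor. -/
theorem injective (h : Module.Injective (NakayamaAlgebra k c) M) :
    Module.Injective (NakayamaAlgebra k (repeatSeries m c)) (PullUp k c m M) := by
  refine ⟨fun X Y _ _ _ _ f hf g => ?_⟩
  let _ : Module (NakayamaAlgebra k c) X := Module.compHom X (toCovering k c m).toRingHom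
  let _ : Module (NakayamaAlgebra k c) Y := Module.compHom Y (toCovering k c m).toRingHom
  obtain ⟨l, hl⟩ := h.out (X := X) (Y := Y)
    { f.toAddMonoidHom with map_smul' := fun a x => f.map_smul (toCovering k c m a) x } hf
    { (counit k c m M).comp g.toAddMonoidHom with
      map_smul' := fun a x => (congrArg (counit k c m M)
        (g.map_smul (toCovering k c m a) x)).trans (counit_smul a (g x)) }
  refine ⟨lift l.toAddMonoidHom fun a y => l.map_smul a y, fun x => ?_⟩
  ext j
  refine (comp_lift _ _ _ _).trans ?_
  rw [← map_smul]
  refine (hl _).trans ?_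
  change counit k c m M (g _) = _
  rw [map_smul, counit_apply]
  simp [comp_e_smul]

/-- The pull-up preserves projective modules, being left adjoint to an exact functor. -/
theorem projective (h : Module.Projective (NakayamaAlgebra k c) M) :
    Module.Projective (NakayamaAlgebra k (repeatSeries m c)) (PullUp k c m M) := by
  refine Module.Projective.of_lifting_property'' fun f hf => ?_
  let _ : Module (NakayamaAlgebra k c) (PullUp k c m M) :=
    Module.compHom _ (toCovering k c m).toRingHom
  let _ : Module (NakayamaAlgebra k c) (PullUp k c m M →₀ NakayamaAlgebra k (repeatSeries m c)) :=
    Module.compHom _ (toCovering k c m).toRingHom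
  obtain ⟨l, hl⟩ := Module.projective_lifting_property
    (R := NakayamaAlgebra k c)
    ({ f.toAddMonoidHom with map_smul' := fun a x => f.map_smul (toCovering k c m a) x } :
      (PullUp k c m M →₀ NakayamaAlgebra k (repeatSeries m c)) →ₗ[NakayamaAlgebra k c] _)
    ({ unit k c m M with map_smul' := unit_smul } : M →ₗ[NakayamaAlgebra k c] PullUp k c m M) hf
  have hg : ∀ a y, l.toAddMonoidHom (a • y) = toCovering k c m a • l.toAddMonoidHom y :=
    fun a y => l.map_smul a y
  refine ⟨desc l.toAddMonoidHom hg, ?_⟩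
  ext1 x
  rw [LinearMap.comp_apply, desc_apply, map_sum, LinearMap.id_apply]
  refine (Finset.sum_congr rfl fun j _ => ?_).trans (sum_e_smul (k := k) (c := repeatSeries m c) x)
  rw [map_smul, ← e_smul_unit_comp j x]
  exact congrArg _ (LinearMap.congr_fun hl (x.comp j))

end PullUp

end Adjunctions

end NakayamaAlgebra

/-! ### Projective and global dimension in terms of modules -/

section ProjectiveDimension

open CategoryTheory

variable (R : Type u) [Ring R]

/-- The projective dimension of the module `M` is less than `d`. -/
abbrev PdLT (M : Type u) [AddCommGroup M] [Module R M] (d : ℕ) : Prop :=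
  HasProjectiveDimensionLT (ModuleCat.of R M) d

variable {R} {M N : Type u} [AddCommGroup M] [Module R M] [AddCommGroup N] [Module R N]

theorem pdLT_zero_iff : PdLT R M 0 ↔ Subsingleton M :=
  (hasProjectiveDimensionLT_zero_iff_isZero _).trans ModuleCat.isZero_iff_subsingleton

theorem pdLT_one_iff : PdLT R M 1 ↔ Module.Projective R M :=
  projective_iff_hasProjectiveDimensionLT_one.symm.trans (IsProjective.iff_projective M).symm

theorem PdLT.congr (e : M ≃ₗ[R] N) {d : ℕ} (h : PdLT R M d) : PdLT R N d :=
  have := h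
  hasProjectiveDimensionLT_of_iso e.toModuleIso d

theorem PdLT.mono {d d' : ℕ} (h : PdLT R M d) (hd : d ≤ d') : PdLT R M d' :=
  have := h
  hasProjectiveDimensionLT_of_ge _ d d' hd

/-- Dimension shifting. -/
theorem pdLT_ker_iff {f : M →ₗ[R] N} (hf : Function.Surjective f) (hM : Module.Projective R M)
    (d : ℕ) : PdLT R N (d + 2) ↔ PdLT R (LinearMap.ker f) (d + 1) :=
  (LinearMap.shortExact_shortComplexKer hf).hasProjectiveDimensionLT_X₃_iff d
    ((IsProjective.iff_projective M).1 hM)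

theorem PdLT.of_quotient {K : Submodule R M} {d : ℕ} (h : PdLT R K d) (h' : PdLT R (M ⧸ K) d) :
    PdLT R M d :=
  (LinearMap.shortExact_shortComplexKer K.mkQ_surjective).hasProjectiveDimensionLT_X₂ d
    (h.congr (LinearEquiv.ofEq _ _ (Submodule.ker_mkQ K).symm)) h'

theorem WithBot.ENat.le_of_forall_natCast {a b : WithBot ℕ∞}
    (h : ∀ d : ℕ, b < (d : ℕ∞) → a < (d : ℕ∞)) : a ≤ b := by
  induction b with
  | bot =>
    have := h 0 (WithBot.bot_lt_coe _)
    induction a with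
    | bot => exact le_rfl
    | coe a => simp at this
  | coe b =>
    induction b with
    | top => exact le_top
    | coe b =>
      have := h (b + 1) (by norm_cast; exact Nat.lt_succ_self b)
      induction a with
      | bot => exact bot_le
      | coe a =>
        rw [WithBot.coe_lt_coe, Nat.cast_succ, ENat.lt_add_one_iff (ENat.natCast_ne_top b)] at this
        exact WithBot.coe_le_coe.2 this

theorem projectiveDimension_le_of_forall {b : WithBot ℕ∞} (h : ∀ d : ℕ, b < (d : ℕ∞) → PdLT R M d) :
    projectiveDimension (ModuleCat.of R M) ≤ b :=
  WithBot.ENat.le_of_forall_natCast fun d hd =>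
    (projectiveDimension_lt_iff (X := ModuleCat.of R M) (n := d)).2 (h d hd)

theorem PdLT.of_globalDimension_lt [Module.Finite R M] {d : ℕ}
    (h : globalDimension R < (d : ℕ∞)) : PdLT R M d := by
  refine (projectiveDimension_lt_iff (X := ModuleCat.of R M) (n := d)).1 (lt_of_le_of_lt ?_ h)
  exact le_iSup₂_of_le (ModuleCat.of R M) ‹_› le_rfl

theorem globalDimension_le {b : WithBot ℕ∞}
    (h : ∀ (M : Type u) [AddCommGroup M] [Module R M] [Module.Finite R M] (d : ℕ),
      b < (d : ℕ∞) → PdLT R M d) : globalDimension R ≤ b :=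
  iSup₂_le fun M hM => have := hM; projectiveDimension_le_of_forall fun d hd => h M d hd

/-- Over a self-injective noetherian ring, finitely generated modules of finite projective dimension
are projective. -/
theorem PdLT.projective_of_selfInjective [IsNoetherianRing R] (hR : Module.Injective R R)
    (d : ℕ) : ∀ (M : Type u) [AddCommGroup M] [Module R M] [Module.Finite R M],
      PdLT R M (d + 1) → Module.Projective R M := by
  induction d with
  | zero => exact fun M _ _ _ h => pdLT_one_iff.1 h
  | succ d ih =>
    intro M _ _ _ h
    obtain ⟨a, f, hf⟩ := Module.Finite.exists_fin' R M
    have hK := ih _ ((pdLT_ker_iff hf inferInstance d).1 h)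
    obtain ⟨b, g, hg⟩ := Module.Finite.exists_fin' R (LinearMap.ker f)
    obtain ⟨s, hs⟩ := Module.projective_lifting_property g LinearMap.id hg
    -- The kernel is injective, as a direct summand of a free module, so its inclusion splits.
    have : Module.Injective R (Fin b → R) := inferInstance
    obtain ⟨t, ht⟩ := this.out (LinearMap.ker f).subtype Subtype.val_injective s
    have hsplit := ((LinearMap.exact_subtype_ker_map f).split_tfae Subtype.val_injective hf).out 1 0
    obtain ⟨q, hq⟩ := hsplit.1 ⟨g ∘ₗ t, by
      ext1 x
      exact (congrArg g (ht x)).trans (LinearMap.congr_fun hs x)⟩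
    exact Module.Projective.of_split q f hq

end ProjectiveDimension

/-! ### Socles and essential submodules -/

namespace NakayamaAlgebra

section ArrowSocle

variable {k : Type u} [Field k] {n : ℕ} [NeZero n] {c : ZMod n → ℕ}
variable (M : Type*) [AddCommGroup M] [Module (NakayamaAlgebra k c) M]

/-- The submodule of the elements annihilated by all arrows.  It is the socle; this description
is the one that is compatible with the pull-up. -/
def arrowSocle : Submodule (NakayamaAlgebra k c) M where
  carrier := {x | ∀ i, α k c i • x = 0}
  add_mem' hx hy i := by rw [smul_add, hx i, hy i, add_zero]
  zero_mem' i := smul_zero _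
  smul_mem' a := by
    induction a using NakayamaAlgebra.induction with
    | scalar r =>
      intro x hx i
      rw [← mul_smul, ← Algebra.commutes, mul_smul, hx i, smul_zero]
    | vertex j =>
      intro x hx i
      rw [← mul_smul, arrow_mul_e]
      split_ifs
      · exact hx i
      · exact zero_smul _ _
    | arrow j => intro x hx i; rw [hx j, smul_zero]
    | add a b ha hb => intro x hx i; rw [add_smul, smul_add, ha hx i, hb hx i, add_zero]
    | mul a b ha hb => intro x hx; rw [mul_smul]; exact ha (hb hx)

variable {M}

theorem eq_zero_of_e_smul {x : M} (h : ∀ i, e k c i • x = 0) : x = 0 := by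
  rw [← sum_e_smul (k := k) (c := c) x]
  exact Finset.sum_eq_zero fun i _ => h i

/-- Every nonzero element is multiplied by some path to a nonzero element of the socle. -/
theorem exists_path_smul_mem_arrowSocle {x : M} (hx : x ≠ 0) :
    ∃ i l, path k c i l • x ≠ 0 ∧ path k c i l • x ∈ arrowSocle (k := k) (c := c) M := by
  obtain ⟨i, hi⟩ := not_forall.1 fun h => hx (eq_zero_of_e_smul (k := k) (c := c) h)
  have hex : ∃ l, path k c i l • x = 0 := ⟨c i, by rw [path_length, zero_smul]⟩
  classical
  obtain ⟨l, hl⟩ : ∃ l, Nat.find hex = l + 1 := Nat.exists_eq_succ_of_ne_zero fun h => hi (by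
    rw [← path_zero, ← h]; exact Nat.find_spec hex)
  refine ⟨i, l, Nat.find_min hex (by omega), fun j => ?_⟩
  rw [← mul_smul, α_mul_path]
  split_ifs
  · rw [← hl]; exact Nat.find_spec hex
  · exact zero_smul _ _

/-- On elements at the vertex `i` annihilated by all arrows, `a` acts as a scalar that depends only
on `a` and `i`. -/
theorem exists_smul_eq_algebraMap_smul (a : NakayamaAlgebra k c) (i : ZMod n) :
    ∃ r : k, ∀ {M : Type u} [AddCommGroup M] [Module (NakayamaAlgebra k c) M] (x : M),
      x ∈ arrowSocle (k := k) (c := c) M → e k c i • x = x →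
        a • x = algebraMap k (NakayamaAlgebra k c) r • x := by
  induction a using NakayamaAlgebra.induction with
  | scalar r => exact ⟨r, fun _ _ _ => rfl⟩
  | vertex j =>
    by_cases h : j = i
    · exact ⟨1, fun x _ hx' => by rw [h, hx', map_one, one_smul]⟩
    · exact ⟨0, fun x _ hx' => by
        rw [map_zero, zero_smul, ← hx', ← mul_smul, e_mul_e_of_ne k c h, zero_smul]⟩
  | arrow j => exact ⟨0, fun x hx _ => by rw [hx j, map_zero, zero_smul]⟩
  | add a b ha hb =>
    obtain ⟨r, hr⟩ := ha
    obtain ⟨s, hs⟩ := hb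
    exact ⟨r + s, fun x hx hx' => by rw [add_smul, hr x hx hx', hs x hx hx', map_add, add_smul]⟩
  | mul a b ha hb =>
    obtain ⟨r, hr⟩ := ha
    obtain ⟨s, hs⟩ := hb
    exact ⟨s * r, fun x hx hx' => by
      rw [mul_smul, hs x hx hx', ← mul_smul, ← Algebra.commutes, mul_smul, hr x hx hx', map_mul,
        mul_smul]⟩

/-- A submodule is essential if and only if it contains the socle. -/
theorem isEssentialSubmodule_iff {M : Type u} [AddCommGroup M] [Module (NakayamaAlgebra k c) M]
    {N : Submodule (NakayamaAlgebra k c) M} : IsEssentialSubmodule N ↔ arrowSocle M ≤ N := by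
  constructor
  · intro h x hx
    rw [← sum_e_smul (k := k) (c := c) x]
    refine N.sum_mem fun i _ => ?_
    by_cases hi : e k c i • x = 0
    · rw [hi]; exact N.zero_mem
    obtain ⟨z, hz, hz0⟩ := Submodule.exists_mem_ne_zero_of_ne_bot
      (h (Submodule.span _ {e k c i • x}) (by simpa using hi))
    obtain ⟨a, rfl⟩ := Submodule.mem_span_singleton.1 hz.2
    obtain ⟨r, hr⟩ := exists_smul_eq_algebraMap_smul (k := k) (c := c) a i
    have hy := hr _ ((arrowSocle M).smul_mem (e k c i) hx) (by rw [← mul_smul, e_mul_e_self])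
    have hr0 : r ≠ 0 := by
      rintro rfl
      rw [hy, map_zero, zero_smul] at hz0
      exact hz0 rfl
    have := N.smul_mem (algebraMap k _ r⁻¹) hz.1
    rwa [hy, ← mul_smul, ← map_mul, inv_mul_cancel₀ hr0, map_one, one_smul] at this
  · intro h L hL hbot
    obtain ⟨x, hx, hx0⟩ := Submodule.exists_mem_ne_zero_of_ne_bot hL
    obtain ⟨i, l, h0, hs⟩ := exists_path_smul_mem_arrowSocle (k := k) (c := c) hx0
    have hmem : path k c i l • x ∈ N ⊓ L := ⟨h hs, L.smul_mem _ hx⟩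
    exact h0 ((Submodule.mem_bot _).1 (hbot ▸ hmem))

/-- A module with finite-dimensional socle is finite-dimensional. -/
theorem finite_of_finite_arrowSocle {M : Type u} [AddCommGroup M] [Module k M]
    [Module (NakayamaAlgebra k c) M] [IsScalarTower k (NakayamaAlgebra k c) M]
    (h : ((arrowSocle (k := k) (c := c) M).restrictScalars k).FG) : Module.Finite k M := by
  -- `V t` consists of the elements annihilated by all paths of length `t`; it is all of `M` for
  -- large `t`, and the arrows map `V (t + 1)` to `V t` with the socle as their common kernel.
  let V : ℕ → Submodule k M := fun t =>
    { carrier := {x | ∀ i, path k c i t • x = 0}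
      add_mem' := fun hx hy i => by rw [smul_add, hx i, hy i, add_zero]
      zero_mem' := fun i => smul_zero _
      smul_mem' := fun r x hx i => by rw [smul_comm, hx i, smul_zero] }
  have hV : ∀ t, (V t).FG := by
    intro t
    induction t with
    | zero =>
      have : V 0 = ⊥ := eq_bot_iff.2 fun x hx => eq_zero_of_e_smul (k := k) (c := c) hx
      rw [this]
      exact Submodule.fg_bot
    | succ t ih =>
      refine Submodule.fg_of_fg_map_of_fg_inf_ker
        (LinearMap.pi fun i => Module.toModuleEnd k M (S := NakayamaAlgebra k c) (α k c i)) ?_ ?_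
      · have : Module.Finite k (V t) := Module.Finite.iff_fg.2 ih
        let f : (ZMod n → V t) →ₗ[k] (ZMod n → M) :=
          LinearMap.pi fun i => (V t).subtype ∘ₗ LinearMap.proj i
        refine Submodule.FG.of_le_of_isNoetherian (T := LinearMap.range f) ?_
        rintro _ ⟨x, hx, rfl⟩
        refine ⟨fun j => ⟨α k c j • x, fun i => ?_⟩, rfl⟩
        rw [← mul_smul, ← path_mul_e_self, mul_assoc, e_mul_arrow]
        split_ifs with hij
        · have := path_mul_path k c j 1 t
          rw [path_succ, path_zero, Nat.cast_zero, Nat.cast_one, add_zero, α_mul_e, add_comm 1 t] at this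
          rw [hij, this]
          exact hx j
        · rw [mul_zero, zero_smul]
      · have : Module.Finite k ((arrowSocle (k := k) (c := c) M).restrictScalars k) :=
          Module.Finite.iff_fg.2 h
        refine Submodule.FG.of_le_of_isNoetherian
          (T := (arrowSocle (k := k) (c := c) M).restrictScalars k) ?_
        rintro x ⟨-, hx⟩ i
        exact congrFun hx i
  refine ⟨?_⟩
  have : V (∑ i, c i) = ⊤ := eq_top_iff.2 fun x _ i => by
    rw [path_eq_zero k c (Finset.single_le_sum (fun _ _ => Nat.zero_le _) (Finset.mem_univ i)),
      zero_smul]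
  rw [← this]
  exact hV _

theorem finite_of_isEssentialSubmodule {M : Type u} [AddCommGroup M]
    [Module (NakayamaAlgebra k c) M] {N : Submodule (NakayamaAlgebra k c) M}
    (hN : N.FG) (h : IsEssentialSubmodule N) : Module.Finite (NakayamaAlgebra k c) M := by
  let _ : Module k M := Module.compHom M (algebraMap k (NakayamaAlgebra k c))
  have : IsScalarTower k (NakayamaAlgebra k c) M := IsScalarTower.of_algebraMap_smul fun _ _ => rfl
  have : Module.Finite (NakayamaAlgebra k c) N := Module.Finite.iff_fg.2 hN
  have : Module.Finite k N := Module.Finite.trans (NakayamaAlgebra k c) N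
  have : Module.Finite k (N.restrictScalars k) := this
  have : Module.Finite k M := finite_of_finite_arrowSocle (k := k) (c := c)
    (Submodule.FG.of_le_of_isNoetherian (T := N.restrictScalars k) (isEssentialSubmodule_iff.1 h))
  exact Module.Finite.of_restrictScalars_finite k _ _

end ArrowSocle

end NakayamaAlgebra

theorem IsCyclicKupischSeries.isKupischSeries {n : ℕ} {c : ZMod n → ℕ} (hc : IsCyclicKupischSeries c) :
    IsKupischSeries c := ⟨fun i => one_le_two.trans (hc.1 i), hc.2⟩

namespace NakayamaAlgebra

/-! ### Simple modules are not projective -/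

section Simple

variable {k : Type u} [Field k] {n : ℕ} [NeZero n] {c : ZMod n → ℕ}

theorem sum_α_mul_path (i : ZMod n) (l : ℕ) :
    ∑ j, α k c j * path k c i l = path k c i (l + 1) := by
  simp only [α_mul_path]
  rw [Finset.sum_ite_eq', if_pos (Finset.mem_univ _)]

/-- An element of `Λ e_i` annihilated by all arrows is a multiple of the longest path starting at
`i`. -/
theorem exists_eq_smul_path (hc : IsKupischSeries c) (a : NakayamaAlgebra k c) (i : ZMod n)
    (h : ∀ j, α k c j * (a * e k c i) = 0) :
    ∃ r : k, a * e k c i = r • path k c i (c i - 1) := by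
  obtain ⟨f, hf⟩ := mul_e_eq_sum a i
  have hci := hc.1 i
  have h0 : ∑ l ∈ Finset.range (c i), f l • path k c i (l + 1) = 0 := by
    refine Eq.trans ?_ (Finset.sum_eq_zero (s := Finset.univ) fun j _ => h j)
    simp only [hf, Finset.mul_sum]
    rw [Finset.sum_comm]
    refine Finset.sum_congr rfl fun l _ => ?_
    simp only [mul_smul_comm]
    rw [← Finset.smul_sum, sum_α_mul_path]
  have hfl : ∀ l, l + 1 < c i → f l = 0 := fun l hl => by
    have := congrArg (fun x => coord hc x (i, l + 1)) h0
    simp only [map_sum, map_smul, map_zero, Finsupp.finsetSum_apply, Finsupp.smul_apply] at this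
    rw [Finset.sum_eq_single l] at this
    · simpa [coord_path hc i hl] using this
    · intro l' hl' hne
      by_cases h' : l' + 1 < c i
      · rw [coord_path hc i h', Finsupp.single_apply, if_neg (by simpa using hne), smul_zero]
      · rw [path_eq_zero k c (not_lt.1 h'), map_zero, Finsupp.zero_apply, smul_zero]
    · intro h'; exact absurd (Finset.mem_range.2 (by omega)) h'
  refine ⟨f (c i - 1), ?_⟩
  rw [hf, Finset.sum_eq_single (c i - 1)]
  · intro l hl hne
    have := Finset.mem_range.1 hl
    rw [hfl l (by omega), zero_smul]
  · intro h'; exact absurd (Finset.mem_range.2 (by omega)) h'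

/-- The one-dimensional representation at the vertex `i`. -/
noncomputable def characterRealization (hc : ∀ i, 1 ≤ c i) (i : ZMod n) : Realization k c k where
  E := Pi.single i 1
  A := 0
  idem j := by by_cases h : j = i <;> simp [h]
  orth j l h := by
    by_cases hj : j = i
    · subst hj; simp [h.symm]
    · simp [Pi.single_apply, hj]
  sum_vertex := by simp
  source j := by simp
  target j := by simp
  zero j := by
    obtain ⟨l, hl⟩ := Nat.exists_eq_add_of_le' (hc j)
    rw [hl, genPath]
    simp

/-- A simple module at a vertex `i` with `2 ≤ c i` is not projective. -/
theorem not_projective_quotient_ker (hc : IsKupischSeries c) (i : ZMod n) (hi : 2 ≤ c i) :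
    ¬ Module.Projective (NakayamaAlgebra k c)
      (NakayamaAlgebra k c ⧸ RingHom.ker (characterRealization (k := k) hc.1 i).lift) := by
  set χ := (characterRealization (k := k) hc.1 i).lift with hχ
  intro hP
  have hα : ∀ j, χ (α k c j) = 0 := fun j => by rw [hχ, Realization.lift_α]; rfl
  obtain ⟨s, hs⟩ := Module.projective_lifting_property (RingHom.ker χ).mkQ LinearMap.id
    (RingHom.ker χ).mkQ_surjective
  set x := s ((RingHom.ker χ).mkQ 1) with hx
  have hx1 : χ x = 1 := by
    have h1 : (RingHom.ker χ).mkQ x = (RingHom.ker χ).mkQ 1 := LinearMap.congr_fun hs _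
    have h2 : x - 1 ∈ RingHom.ker χ := (Submodule.Quotient.eq _).1 h1
    rw [RingHom.mem_ker, map_sub, map_one, sub_eq_zero] at h2
    exact h2
  have hαx : ∀ j, α k c j * x = 0 := fun j => by
    rw [← smul_eq_mul, hx, ← map_smul, ← map_smul, smul_eq_mul, mul_one, Submodule.mkQ_apply,
      (Submodule.Quotient.mk_eq_zero _).2 (RingHom.mem_ker.2 (hα j)), map_zero]
  obtain ⟨r, hr⟩ := exists_eq_smul_path hc x i fun j => by rw [← mul_assoc, hαx, zero_mul]
  obtain ⟨l, hl⟩ := Nat.exists_eq_add_of_le' hi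
  have := congrArg χ hr
  rw [hl, Nat.add_succ_sub_one, path_succ, map_mul, hx1, map_smul, map_mul, hα, zero_mul, smul_zero,
    hχ, Realization.lift_e] at this
  simp [characterRealization] at this

end Simple

/-! ### The dominant dimension is at most the global dimension -/

section DominantDimension

variable {k : Type u} [Field k] {n : ℕ} [NeZero n] {c : ZMod n → ℕ}

instance : IsNoetherianRing (NakayamaAlgebra k c) := IsNoetherianRing.of_finite k _

instance : IsArtinianRing (NakayamaAlgebra k c) := IsArtinianRing.of_finite k _

theorem finite_minimalInjectiveResolution
    (X : MinimalInjectiveResolution (NakayamaAlgebra k c) (NakayamaAlgebra k c)) (j : ℕ) :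
    Module.Finite (NakayamaAlgebra k c) (X.I j) := by
  induction j with
  | zero => exact finite_of_isEssentialSubmodule (Submodule.FG.of_finite) X.essential_zero
  | succ j ih => exact finite_of_isEssentialSubmodule (Submodule.FG.of_finite) (X.essential_succ j)

/-- If a minimal injective resolution of `R` starts with projective modules `I 0, …, I d` and the
cokernel of the last map has projective dimension at most `d`, then `R` is injective. -/
theorem _root_.MinimalInjectiveResolution.injective_self {R : Type u} [Ring R]
    (X : MinimalInjectiveResolution R R) (d : ℕ) (hp : ∀ j ≤ d, Module.Projective R (X.I j))
    (hd : PdLT R (LinearMap.range (X.d d)) (d + 1)) : Module.Injective R R := by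
  have key : ∀ e j, j + e = d → PdLT R (LinearMap.range (X.d j)) (j + 1) := by
    intro e
    induction e with
    | zero => rintro j rfl; exact hd
    | succ e ih =>
      intro j hj
      have := (pdLT_ker_iff (X.d (j + 1)).surjective_rangeRestrict (hp (j + 1) (by omega)) j).1
        (ih (j + 1) (by omega))
      refine this.congr (LinearEquiv.ofEq _ _ ?_)
      rw [LinearMap.ker_rangeRestrict]
      exact (X.exact_succ j).linearMap_ker_eq
  have hP : Module.Projective R (LinearMap.range (X.d 0)) := pdLT_one_iff.1 (key d 0 (by omega))
  obtain ⟨s, hs⟩ := Module.projective_lifting_property (X.d 0).rangeRestrict LinearMap.id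
    (X.d 0).surjective_rangeRestrict
  have hs' : ∀ y, X.d 0 (s y) = y := fun y => congrArg Subtype.val (LinearMap.congr_fun hs y)
  -- The image of the section is a complement of the essential submodule `range ι`.
  have hbot : LinearMap.range s = ⊥ := by
    by_contra h
    refine X.essential_zero _ h (eq_bot_iff.2 ?_)
    rintro _ ⟨⟨x, rfl⟩, ⟨y, hy⟩⟩
    have h0 : (y : X.I (0 + 1)) = 0 := by
      rw [← hs', hy]
      exact (X.exact_zero _).2 ⟨x, rfl⟩
    rw [← hy, show y = 0 from Subtype.ext h0, map_zero]
    exact Submodule.zero_mem _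
  have hsurj : Function.Surjective X.ι := fun x => by
    refine (X.exact_zero x).1 ?_
    have h1 : s ((X.d 0).rangeRestrict x) ∈ LinearMap.range s := ⟨_, rfl⟩
    rw [hbot, Submodule.mem_bot] at h1
    have h2 := hs' ((X.d 0).rangeRestrict x)
    rw [h1, map_zero] at h2
    exact h2.symm
  let ε := LinearEquiv.ofBijective X.ι ⟨X.ι_injective, hsurj⟩
  refine ⟨fun A B _ _ _ _ f hf g => ?_⟩
  obtain ⟨h, hh⟩ := (X.injective 0).out f hf (ε.toLinearMap ∘ₗ g)
  refine ⟨ε.symm.toLinearMap ∘ₗ h, fun x => ?_⟩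
  rw [LinearMap.comp_apply, hh]
  exact ε.symm_apply_apply _

/-- If the dominant dimension were larger, the algebra would be self-injective of finite global
dimension, and the simple modules would be projective. -/
theorem dominantDimension_le_globalDimension (hc : IsCyclicKupischSeries c) :
    (dominantDimension (NakayamaAlgebra k c) : WithBot ℕ∞) ≤
      globalDimension (NakayamaAlgebra k c) := by
  have hS := not_projective_quotient_ker (k := k) hc.isKupischSeries 0 (hc.1 0)
  have hT : ∀ t : ℕ∞, (∃ X : MinimalInjectiveResolution (NakayamaAlgebra k c) (NakayamaAlgebra k c),
      ∀ j : ℕ, (j : ℕ∞) < t → Module.Projective (NakayamaAlgebra k c) (X.I j)) →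
      (t : WithBot ℕ∞) ≤ globalDimension (NakayamaAlgebra k c) := by
    rintro t ⟨X, hX⟩
    by_contra! hlt
    have hbot : globalDimension (NakayamaAlgebra k c) ≠ ⊥ := fun h => by
      refine hS (pdLT_one_iff.1 (PdLT.of_globalDimension_lt ?_))
      rw [h]
      exact WithBot.bot_lt_coe _
    obtain ⟨g, hg⟩ := WithBot.ne_bot_iff_exists.1 hbot
    rw [← hg, WithBot.coe_lt_coe] at hlt
    obtain ⟨d, rfl⟩ := ENat.ne_top_iff_exists.1 hlt.ne_top
    have hd : globalDimension (NakayamaAlgebra k c) < ((d + 1 : ℕ) : ℕ∞) := by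
      rw [← hg]
      exact_mod_cast Nat.lt_succ_self d
    have := finite_minimalInjectiveResolution X d
    have hinj := X.injective_self d
      (fun j hj => hX j (lt_of_le_of_lt (by exact_mod_cast hj) hlt)) (PdLT.of_globalDimension_lt hd)
    exact hS (PdLT.projective_of_selfInjective hinj d _ (PdLT.of_globalDimension_lt hd))
  rcases hb : globalDimension (NakayamaAlgebra k c) with _ | b
  · exact absurd (hS (pdLT_one_iff.1 (PdLT.of_globalDimension_lt
      (by rw [hb]; exact WithBot.bot_lt_coe _)))) id
  · refine WithBot.coe_le_coe.2 (sSup_le fun t ht => ?_)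
    have := hT t ht
    rw [hb] at this
    exact WithBot.coe_le_coe.1 this

end DominantDimension

end NakayamaAlgebra

/-! ### Homological dimensions of coverings -/

namespace NakayamaAlgebra

section PushDown

/-- The push-down of a module over the `m`-fold covering: its restriction along `toCovering`. -/
def PushDown (_k : Type u) {n : ℕ} (_c : ZMod n → ℕ) (_m : ℕ) (N : Type u) : Type u := N

variable (k : Type u) [Field k] {n : ℕ} [NeZero n] (c : ZMod n → ℕ) (m : ℕ) [NeZero m]
variable (N : Type u) [AddCommGroup N] [Module (NakayamaAlgebra k (repeatSeries m c)) N]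

instance : AddCommGroup (PushDown k c m N) := inferInstanceAs (AddCommGroup N)

noncomputable instance : Module (NakayamaAlgebra k c) (PushDown k c m N) :=
  Module.compHom N (toCovering k c m).toRingHom

noncomputable instance : Module k (PushDown k c m N) :=
  Module.compHom N (algebraMap k (NakayamaAlgebra k (repeatSeries m c)))

instance : IsScalarTower k (NakayamaAlgebra k c) (PushDown k c m N) :=
  IsScalarTower.of_algebraMap_smul fun r x => by
    change toCovering k c m (algebraMap k _ r) • (show N from x) = _
    rw [AlgHom.commutes]
    rfl

variable {k c m N} {N' : Type u} [AddCommGroup N']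
  [Module (NakayamaAlgebra k (repeatSeries m c)) N']

namespace PushDown

variable (k c m N) in
/-- The identity, as a map to the push-down. -/
def of : N ≃+ PushDown k c m N := AddEquiv.refl N

/-- The functoriality of the push-down. -/
noncomputable def map (f : N →ₗ[NakayamaAlgebra k (repeatSeries m c)] N') :
    PushDown k c m N →ₗ[NakayamaAlgebra k c] PushDown k c m N' where
  toFun x := of k c m N' (f ((of k c m N).symm x))
  map_add' x y := by simp
  map_smul' a x := f.map_smul (toCovering k c m a) ((of k c m N).symm x)

/-- The kernel of the push-down of a map is the push-down of the kernel. -/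
noncomputable def kerMapEquiv (f : N →ₗ[NakayamaAlgebra k (repeatSeries m c)] N') :
    LinearMap.ker (map f : PushDown k c m N →ₗ[NakayamaAlgebra k c] _)
      ≃ₗ[NakayamaAlgebra k c] PushDown k c m (LinearMap.ker f) where
  toFun x := of k c m _ ⟨(of k c m N).symm x.1, x.2⟩
  invFun x := ⟨of k c m N ((of k c m _).symm x).1, ((of k c m _).symm x).2⟩
  map_add' _ _ := rfl
  map_smul' _ _ := rfl
  left_inv _ := rfl
  right_inv _ := rfl

/-- A module over the covering is projective if and only if its push-down is: the push-down
is left adjoint to the exact pull-up, and every module is a direct summand of the pull-up of its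
push-down. -/
theorem projective_iff : Module.Projective (NakayamaAlgebra k c) (PushDown k c m N) ↔
    Module.Projective (NakayamaAlgebra k (repeatSeries m c)) N := by
  have hof : ∀ (a : NakayamaAlgebra k c) (y : N), (of k c m N).toAddMonoidHom
      (toCovering k c m a • y) = a • (of k c m N).toAddMonoidHom y := fun _ _ => rfl
  have hof' : ∀ (a : NakayamaAlgebra k c) (y : PushDown k c m N),
      (of k c m N).symm.toAddMonoidHom (a • y) =
        toCovering k c m a • (of k c m N).symm.toAddMonoidHom y := fun _ _ => rfl
  constructor
  · intro h
    have := PullUp.projective (m := m) h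
    refine Module.Projective.of_split (PullUp.lift _ hof) (PullUp.desc _ hof') ?_
    ext1 y
    rw [LinearMap.comp_apply, PullUp.desc_apply]
    refine Eq.trans (Finset.sum_congr rfl fun j _ => ?_)
      (sum_e_smul (k := k) (c := repeatSeries m c) y)
    change e k _ j • e k (repeatSeries m c) j • y = _
    rw [← mul_smul, e_mul_e_self]
  · intro h
    refine Module.Projective.of_lifting_property'' fun f hf => ?_
    obtain ⟨l, hl⟩ := Module.projective_lifting_property (PullUp.map (m := m) f)
      (PullUp.lift _ hof) (PullUp.map_surjective hf)
    refine ⟨{ (PullUp.counit k c m _).comp (l.toAddMonoidHom.comp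
      (of k c m N).symm.toAddMonoidHom) with
        map_smul' := fun a x => (congrArg (PullUp.counit k c m _)
          (l.map_smul (toCovering k c m a) ((of k c m N).symm x))).trans
            (PullUp.counit_smul a _) }, ?_⟩
    ext1 x
    change f (∑ j, (l ((of k c m N).symm x)).comp j) = x
    rw [map_sum]
    have := LinearMap.congr_fun hl ((of k c m N).symm x)
    refine Eq.trans (Finset.sum_congr rfl fun j _ =>
      congrArg (fun z : PullUp k c m (PushDown k c m N) => z.comp j) this) ?_
    have hx := sum_e_smul (k := k) (c := repeatSeries m c) (show N from x)
    exact hx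

/-- The push-down is exact and both preserves and reflects projective modules, so it preserves
projective dimensions. -/
theorem pdLT_iff (d : ℕ) : ∀ (N : Type u) [AddCommGroup N]
    [Module (NakayamaAlgebra k (repeatSeries m c)) N],
    PdLT (NakayamaAlgebra k c) (PushDown k c m N) d ↔
      PdLT (NakayamaAlgebra k (repeatSeries m c)) N d := by
  match d with
  | 0 =>
    exact fun N _ _ => (pdLT_zero_iff (M := PushDown k c m N)).trans
      (pdLT_zero_iff (R := NakayamaAlgebra k (repeatSeries m c)) (M := N)).symm
  | 1 => exact fun N _ _ => pdLT_one_iff.trans (projective_iff.trans pdLT_one_iff.symm)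
  | d + 2 =>
    intro N _ _
    let f := Finsupp.linearCombination (NakayamaAlgebra k (repeatSeries m c)) (id : N → N)
    have hf : Function.Surjective f :=
      Finsupp.linearCombination_surjective _ Function.surjective_id
    have hf' : Function.Surjective (map f : _ →ₗ[NakayamaAlgebra k c] PushDown k c m N) := hf
    rw [pdLT_ker_iff hf inferInstance, pdLT_ker_iff hf' (projective_iff.2 inferInstance),
      ← pdLT_iff (d + 1)]
    exact ⟨fun h => h.congr (kerMapEquiv f), fun h => h.congr (kerMapEquiv f).symm⟩

theorem finite [Module.Finite (NakayamaAlgebra k (repeatSeries m c)) N] :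
    Module.Finite (NakayamaAlgebra k c) (PushDown k c m N) := by
  let _ : Module k N := Module.compHom N (algebraMap k (NakayamaAlgebra k (repeatSeries m c)))
  have : IsScalarTower k (NakayamaAlgebra k (repeatSeries m c)) N :=
    IsScalarTower.of_algebraMap_smul fun _ _ => rfl
  have h : Module.Finite k N := Module.Finite.trans (NakayamaAlgebra k (repeatSeries m c)) N
  have : Module.Finite k (PushDown k c m N) := h
  exact Module.Finite.of_restrictScalars_finite k _ _

end PushDown

end PushDown

section GlobalDimension

variable (k : Type u) [Field k] {n : ℕ} [NeZero n] {c : ZMod n → ℕ} (m : ℕ) [NeZero m]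

theorem globalDimension_repeatSeries_le :
    globalDimension (NakayamaAlgebra k (repeatSeries m c)) ≤
      globalDimension (NakayamaAlgebra k c) :=
  globalDimension_le fun N _ _ _ d hd =>
    have := PushDown.finite (k := k) (c := c) (m := m) (N := N)
    (PushDown.pdLT_iff d N).1 (PdLT.of_globalDimension_lt hd)

/-- The vertices of `Λ`, placed at chosen preimages in the covering, with the arrows acting as
zero. -/
noncomputable def sectionRealization (hc : ∀ i, 1 ≤ c i) :
    Realization k (repeatSeries m c) (NakayamaAlgebra k c) where
  E j := if j = Function.surjInv (proj_surjective m) (proj n m j) then e k c (proj n m j) else 0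
  A _ := 0
  idem j := by split_ifs <;> simp [e_mul_e_self]
  orth i j h := by
    split_ifs with hi hj
    · refine e_mul_e_of_ne k c fun h' => h ?_
      rw [hi, hj, h']
    all_goals simp
  sum_vertex := by
    classical
    rw [← sum_e k c, ← Finset.sum_fiberwise Finset.univ (proj n m)]
    refine Finset.sum_congr rfl fun i _ => ?_
    refine (Finset.sum_congr (g := fun j =>
      if j = Function.surjInv (proj_surjective m) i then e k c i else 0) rfl
      fun j hj => ?_).trans ?_
    · rw [(Finset.mem_filter_univ j).1 hj]
    · rw [Finset.sum_ite_eq', if_pos]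
      exact (Finset.mem_filter_univ _).2 (Function.surjInv_eq (proj_surjective m) i)
  source j := by simp
  target j := by simp
  zero j := by
    obtain ⟨l, hl⟩ := Nat.exists_eq_add_of_le' (hc (proj n m j))
    rw [repeatSeries_apply, hl, genPath]
    simp

theorem sectionRealization_toCovering_e (hc : ∀ i, 1 ≤ c i) (i : ZMod n) :
    (sectionRealization k m hc).lift (toCovering k c m (e k c i)) = e k c i := by
  classical
  rw [toCovering, Realization.lift_e]
  simp only [fiberRealization, map_sum, Realization.lift_e]
  refine (Finset.sum_congr (g := fun j =>
    if j = Function.surjInv (proj_surjective m) i then e k c i else 0) rfl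
    fun j hj => ?_).trans ?_
  · simp only [sectionRealization, (Finset.mem_filter_univ j).1 hj]
  · rw [Finset.sum_ite_eq', if_pos]
    exact (Finset.mem_filter_univ _).2 (Function.surjInv_eq (proj_surjective m) i)

theorem sectionRealization_toCovering_α (hc : ∀ i, 1 ≤ c i) (i : ZMod n) :
    (sectionRealization k m hc).lift (toCovering k c m (α k c i)) = 0 := by
  rw [toCovering, Realization.lift_α]
  simp [fiberRealization, map_sum, Realization.lift_α, sectionRealization]

variable {k} in
/-- A semisimple `Λ`-module is the push-down of a module over the covering. -/
theorem PdLT.of_arrowSocle_eq_top (hc : ∀ i, 1 ≤ c i) {M : Type u} [AddCommGroup M]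
    [Module (NakayamaAlgebra k c) M] [Module.Finite (NakayamaAlgebra k c) M]
    (hM : arrowSocle (k := k) (c := c) M = ⊤) {d : ℕ}
    (hd : globalDimension (NakayamaAlgebra k (repeatSeries m c)) < (d : ℕ∞)) :
    PdLT (NakayamaAlgebra k c) M d := by
  let _ : Module (NakayamaAlgebra k (repeatSeries m c)) M :=
    Module.compHom M (sectionRealization k m hc).lift.toRingHom
  let _ : Module k M := Module.compHom M (algebraMap k (NakayamaAlgebra k c))
  have : IsScalarTower k (NakayamaAlgebra k c) M :=
    IsScalarTower.of_algebraMap_smul fun _ _ => rfl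
  have : IsScalarTower k (NakayamaAlgebra k (repeatSeries m c)) M :=
    IsScalarTower.of_algebraMap_smul fun r x => by
      change (sectionRealization k m hc).lift (algebraMap k _ r) • x = _
      rw [AlgHom.commutes]
      rfl
  have : Module.Finite k M := Module.Finite.trans (NakayamaAlgebra k c) M
  have : Module.Finite (NakayamaAlgebra k (repeatSeries m c)) M :=
    Module.Finite.of_restrictScalars_finite k _ _
  refine ((PushDown.pdLT_iff d M).2 (PdLT.of_globalDimension_lt hd)).congr
    (LinearEquiv.ofBijective (linearOfGenerators (k := k) (c := c)
      (PushDown.of k c m M).symm.toAddMonoidHom ?_ ?_ ?_) (PushDown.of k c m M).symm.bijective)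
  · intro r x
    have h : (sectionRealization k m hc).lift (toCovering k c m (algebraMap k _ r)) =
        algebraMap k _ r := by rw [AlgHom.commutes, AlgHom.commutes]
    exact congrArg (fun a : NakayamaAlgebra k c => a • (show M from x)) h
  · intro i x
    exact congrArg (fun a : NakayamaAlgebra k c => a • (show M from x))
      (sectionRealization_toCovering_e k m hc i)
  · intro i x
    have hx : (show M from x) ∈ arrowSocle (k := k) (c := c) M := hM ▸ trivial
    refine Eq.trans ?_ (hx i).symm
    exact (congrArg (fun a : NakayamaAlgebra k c => a • (show M from x))
      (sectionRealization_toCovering_α k m hc i)).trans (zero_smul _ _)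

theorem arrowSocle_eq_top_of_isSimpleModule (M : Type u) [AddCommGroup M]
    [Module (NakayamaAlgebra k c) M] [IsSimpleModule (NakayamaAlgebra k c) M] :
    arrowSocle (k := k) (c := c) M = ⊤ := by
  refine (eq_bot_or_eq_top _).resolve_left fun h => ?_
  have := IsSimpleModule.nontrivial (NakayamaAlgebra k c) M
  obtain ⟨x, hx⟩ := exists_ne (0 : M)
  obtain ⟨i, l, h0, hs⟩ := exists_path_smul_mem_arrowSocle (k := k) (c := c) hx
  exact h0 ((Submodule.mem_bot _).1 (h ▸ hs))

/-- The global dimension of `Λ` is attained on simple modules, and these are push-downs. -/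
theorem globalDimension_repeatSeries (hc : ∀ i, 1 ≤ c i) :
    globalDimension (NakayamaAlgebra k (repeatSeries m c)) =
      globalDimension (NakayamaAlgebra k c) := by
  refine le_antisymm (globalDimension_repeatSeries_le k m) (globalDimension_le ?_)
  intro M _ _ _ d hd
  have : IsFiniteLength (NakayamaAlgebra k c) M :=
    isFiniteLength_iff_isNoetherian_isArtinian.2 ⟨inferInstance, inferInstance⟩
  induction this with
  | of_subsingleton => exact (pdLT_zero_iff.2 inferInstance).mono (Nat.zero_le d)
  | of_simple_quotient _ ih =>
    rename_i N _ _
    refine PdLT.of_quotient (K := N) ih ?_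
    exact PdLT.of_arrowSocle_eq_top m hc (arrowSocle_eq_top_of_isSimpleModule k _) hd

end GlobalDimension

section DominantDimension

variable (k : Type u) [Field k] {n : ℕ} [NeZero n] (c : ZMod n → ℕ) (m : ℕ) [NeZero m]

/-- The components of an element of the socle of a pull-up are in the socle. -/
theorem PullUp.isEssentialSubmodule_range_map {k : Type u} [Field k] {n : ℕ} [NeZero n]
    {c : ZMod n → ℕ} (m : ℕ) [NeZero m] {M M' : Type u} [AddCommGroup M] [Module k M]
    [Module (NakayamaAlgebra k c) M] [IsScalarTower k (NakayamaAlgebra k c) M] [AddCommGroup M']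
    [Module k M'] [Module (NakayamaAlgebra k c) M'] [IsScalarTower k (NakayamaAlgebra k c) M']
    {f : M →ₗ[NakayamaAlgebra k c] M'} (hf : IsEssentialSubmodule (LinearMap.range f)) :
    IsEssentialSubmodule (LinearMap.range (PullUp.map f : PullUp k c m M →ₗ[_] _)) := by
  rw [isEssentialSubmodule_iff] at hf ⊢
  intro x hx
  have : ∀ j, x.comp j ∈ arrowSocle (k := k) (c := c) M' := fun j i => by
    by_cases h : i = proj n m j
    · subst h
      have := congrArg (fun z : PullUp k c m M' => z.comp (j + 1)) (hx j)
      rwa [PullUp.comp_α_smul, if_pos rfl] at this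
    · rw [← PullUp.e_smul_comp, ← mul_smul, arrow_mul_e, if_neg h, zero_smul]
  choose y hy using fun j => hf (this j)
  refine ⟨PullUp.ofComp (fun j => e k c (proj n m j) • y j) fun j => ?_, ?_⟩
  · rw [← mul_smul, e_mul_e_self]
  · ext j
    rw [PullUp.comp_map, PullUp.comp_ofComp, map_smul, hy, PullUp.e_smul_comp]

/-- The pull-up of a minimal injective resolution of `Λ` is one of its covering. -/
noncomputable def pullUpResolution
    (X : MinimalInjectiveResolution (NakayamaAlgebra k c) (NakayamaAlgebra k c)) :
    MinimalInjectiveResolution (NakayamaAlgebra k (repeatSeries m c))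
      (NakayamaAlgebra k (repeatSeries m c)) :=
  letI : ∀ j, Module k (X.I j) := fun j => Module.compHom _ (algebraMap k (NakayamaAlgebra k c))
  haveI : ∀ j, IsScalarTower k (NakayamaAlgebra k c) (X.I j) := fun _ =>
    IsScalarTower.of_algebraMap_smul fun _ _ => rfl
  { I j := ModuleCat.of _ (PullUp k c m (X.I j))
    ι := PullUp.map X.ι ∘ₗ (PullUp.regularEquiv k c m).toLinearMap
    d j := PullUp.map (X.d j)
    injective j := PullUp.injective (X.injective j)
    ι_injective := (PullUp.map_injective X.ι_injective).comp (PullUp.regularEquiv k c m).injective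
    exact_zero := by
      have h := PullUp.map_exact (m := m) X.exact_zero
      intro y
      rw [h y]
      exact ⟨fun ⟨x, hx⟩ => ⟨(PullUp.regularEquiv k c m).symm x, by simpa using hx⟩,
        fun ⟨x, hx⟩ => ⟨_, hx⟩⟩
    exact_succ j := PullUp.map_exact (X.exact_succ j)
    essential_zero := by
      rw [LinearMap.range_comp_of_range_eq_top _ (LinearEquiv.range _)]
      exact PullUp.isEssentialSubmodule_range_map m X.essential_zero
    essential_succ j := PullUp.isEssentialSubmodule_range_map m (X.essential_succ j) }

theorem dominantDimension_le_repeatSeries : dominantDimension (NakayamaAlgebra k c) ≤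
    dominantDimension (NakayamaAlgebra k (repeatSeries m c)) :=
  sSup_le_sSup fun _ ⟨X, hX⟩ =>
    ⟨pullUpResolution k c m X, fun j hj => by
      let _ : Module k (X.I j) := Module.compHom _ (algebraMap k (NakayamaAlgebra k c))
      have : IsScalarTower k (NakayamaAlgebra k c) (X.I j) :=
        IsScalarTower.of_algebraMap_smul fun _ _ => rfl
      exact PullUp.projective (m := m) (hX j hj)⟩

variable {k c} in
theorem isHigherAuslander_repeatSeries (hc : IsCyclicKupischSeries c)
    (h : IsHigherAuslander (NakayamaAlgebra k c)) :
    IsHigherAuslander (NakayamaAlgebra k (repeatSeries m c)) := by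
  have hc' : IsCyclicKupischSeries (repeatSeries m c) :=
    ⟨fun i => hc.1 _, (isKupischSeries_repeatSeries m hc.isKupischSeries).2⟩
  refine le_antisymm (dominantDimension_le_globalDimension hc') ?_
  rw [globalDimension_repeatSeries k m hc.isKupischSeries.1, ← h]
  exact WithBot.coe_le_coe.2 (dominantDimension_le_repeatSeries k c m)

end DominantDimension

end NakayamaAlgebra

/-! ### Socles of the indecomposable projective modules -/

namespace NakayamaAlgebra

section Socles

variable {k : Type u} [Field k] {n : ℕ} [NeZero n] {c : ZMod n → ℕ}

theorem mem_P_iff {i : ZMod n} {x : NakayamaAlgebra k c} : x ∈ P k c i ↔ x * e k c i = x := by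
  rw [P, Submodule.mem_span_singleton]
  constructor
  · rintro ⟨a, rfl⟩
    rw [smul_eq_mul, mul_assoc, e_mul_e_self]
  · exact fun h => ⟨x, h⟩

theorem path_mem_P (i : ZMod n) (l : ℕ) : path k c i l ∈ P k c i :=
  mem_P_iff.2 (path_mul_e_self k c i l)

theorem exists_smul_eq_of_mem_arrowSocle_P (hc : IsKupischSeries c) {i : ZMod n} {x : P k c i}
    (hx : x ∈ arrowSocle (k := k) (c := c) (P k c i)) :
    ∃ r : k, (x : NakayamaAlgebra k c) = r • path k c i (c i - 1) := by
  obtain ⟨r, hr⟩ := exists_eq_smul_path hc (x : NakayamaAlgebra k c) i fun j => by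
    rw [mem_P_iff.1 x.2]
    exact congrArg Subtype.val (hx j)
  exact ⟨r, by rw [← hr, mem_P_iff.1 x.2]⟩

variable (k) in
/-- The longest nonzero path starting at `i`, as an element of the socle of `P_i`. -/
noncomputable def longestPath (hc : IsKupischSeries c) (i : ZMod n) :
    arrowSocle (k := k) (c := c) (P k c i) :=
  ⟨⟨path k c i (c i - 1), path_mem_P i _⟩, fun j => Subtype.ext (by
    have := hc.1 i
    change α k c j * path k c i (c i - 1) = 0
    rw [α_mul_path]
    split_ifs
    · exact path_eq_zero k c (by omega)
    · rfl)⟩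

theorem longestPath_ne_zero (hc : IsKupischSeries c) (i : ZMod n) : longestPath k hc i ≠ 0 :=
  fun h => path_ne_zero (k := k) hc i (l := c i - 1) (by have := hc.1 i; omega)
    (congrArg (fun x : arrowSocle (k := k) (c := c) (P k c i) => (x.1 : NakayamaAlgebra k c)) h)

theorem exists_eq_smul_longestPath (hc : IsKupischSeries c) {i : ZMod n}
    (x : arrowSocle (k := k) (c := c) (P k c i)) :
    ∃ r : k, x = algebraMap k (NakayamaAlgebra k c) r • longestPath k hc i := by
  obtain ⟨r, hr⟩ := exists_smul_eq_of_mem_arrowSocle_P hc x.2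
  exact ⟨r, Subtype.ext (Subtype.ext (hr.trans (Algebra.smul_def _ _)))⟩

theorem isSimpleModule_arrowSocle_P (hc : IsKupischSeries c) (i : ZMod n) :
    IsSimpleModule (NakayamaAlgebra k c) (arrowSocle (k := k) (c := c) (P k c i)) := by
  refine isSimpleModule_iff_toSpanSingleton_surjective.2
    ⟨⟨_, _, longestPath_ne_zero hc i⟩, fun x hx y => ?_⟩
  obtain ⟨r, rfl⟩ := exists_eq_smul_longestPath hc x
  obtain ⟨s, rfl⟩ := exists_eq_smul_longestPath hc y
  have hr : r ≠ 0 := by rintro rfl; simp at hx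
  refine ⟨algebraMap k _ (s * r⁻¹), ?_⟩
  rw [LinearMap.toSpanSingleton_apply, ← mul_smul, ← map_mul, inv_mul_cancel_right₀ hr]

theorem moduleSocle_P (hc : IsKupischSeries c) (i : ZMod n) :
    moduleSocle (NakayamaAlgebra k c) (P k c i) = arrowSocle (P k c i) := by
  refine le_antisymm (sSup_le fun N hN x hx j => ?_) (le_sSup (isSimpleModule_arrowSocle_P hc i))
  have hN' : IsSimpleModule (NakayamaAlgebra k c) N := hN
  have hx' : (⟨x, hx⟩ : N) ∈ arrowSocle (k := k) (c := c) N := by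
    rw [arrowSocle_eq_top_of_isSimpleModule]; trivial
  exact congrArg Subtype.val (hx' j)

variable (k c) in
/-- The image of the vertex `i` in the simple module `S_i`. -/
noncomputable def topGenerator (i : ZMod n) : S k c i :=
  Submodule.Quotient.mk ⟨e k c i, path_mem_P i 0⟩

theorem e_smul_topGenerator (i : ZMod n) : e k c i • topGenerator k c i = topGenerator k c i :=
  congrArg Submodule.Quotient.mk (Subtype.ext (e_mul_e_self k c i))

theorem topGenerator_mem_arrowSocle (i : ZMod n) :
    topGenerator k c i ∈ arrowSocle (k := k) (c := c) (S k c i) := by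
  intro j
  refine (Submodule.Quotient.mk_eq_zero _).2 ?_
  refine (Submodule.mem_sInf).2 fun N hN => ?_
  have : IsSimpleModule (NakayamaAlgebra k c) (P k c i ⧸ N) := isSimpleModule_iff_isCoatom.2 hN
  have h : (Submodule.Quotient.mk ⟨e k c i, path_mem_P i 0⟩ : P k c i ⧸ N) ∈
      arrowSocle (k := k) (c := c) (P k c i ⧸ N) := by
    rw [arrowSocle_eq_top_of_isSimpleModule]; trivial
  exact (Submodule.Quotient.mk_eq_zero _).1 (h j)

theorem mk_eq_smul_topGenerator {i : ZMod n} (x : P k c i) :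
    (Submodule.Quotient.mk x : S k c i) = (x : NakayamaAlgebra k c) • topGenerator k c i :=
  congrArg Submodule.Quotient.mk (Subtype.ext (mem_P_iff.1 x.2).symm)

theorem e_smul_longestPath (hc : IsKupischSeries c) (i : ZMod n) :
    e k c (i + ((c i - 1 : ℕ) : ZMod n)) • longestPath k hc i = longestPath k hc i :=
  Subtype.ext (Subtype.ext (e_mul_path_self k c i _))

/-- The socle of `P_i` is the simple module at the end of the longest path starting at `i`. -/
theorem nonempty_socle_equiv_iff (hc : IsKupischSeries c) (i j : ZMod n) :
    Nonempty (moduleSocle (NakayamaAlgebra k c) (P k c i) ≃ₗ[NakayamaAlgebra k c] S k c j) ↔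
      j = i + ((c i - 1 : ℕ) : ZMod n) := by
  rw [moduleSocle_P hc]
  constructor
  · rintro ⟨f⟩
    by_contra hne
    obtain ⟨x, hx⟩ := Submodule.Quotient.mk_surjective _ (f (longestPath k hc i))
    obtain ⟨r, hr⟩ := exists_smul_eq_algebraMap_smul (x : NakayamaAlgebra k c) j
    rw [mk_eq_smul_topGenerator,
      hr _ (topGenerator_mem_arrowSocle j) (e_smul_topGenerator j)] at hx
    have h1 := congrArg f (e_smul_longestPath hc i)
    rw [map_smul, ← hx, ← mul_smul, ← Algebra.commutes, mul_smul, ← e_smul_topGenerator,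
      ← mul_smul (e k c _), e_mul_e_of_ne k c (Ne.symm hne), zero_smul, smul_zero] at h1
    rw [← e_smul_topGenerator, ← h1] at hx
    exact longestPath_ne_zero hc i (f.map_eq_zero_iff.1 hx.symm)
  · rintro rfl
    set j := i + ((c i - 1 : ℕ) : ZMod n)
    have := isSimpleModule_arrowSocle_P (k := k) hc i
    let f : P k c j →ₗ[NakayamaAlgebra k c] arrowSocle (k := k) (c := c) (P k c i) :=
      LinearMap.toSpanSingleton _ _ (longestPath k hc i) ∘ₗ (P k c j).subtype
    have hf : Function.Surjective f := fun y => by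
      obtain ⟨r, rfl⟩ := exists_eq_smul_longestPath hc y
      refine ⟨algebraMap k (NakayamaAlgebra k c) r • ⟨e k c j, path_mem_P j 0⟩, ?_⟩
      rw [map_smul]
      exact congrArg _ (e_smul_longestPath hc i)
    have hker : LinearMap.ker f = Module.jacobson (NakayamaAlgebra k c) (P k c j) := by
      refine le_antisymm (fun x hx => ?_) (sInf_le (LinearMap.isCoatom_ker_of_surjective hf))
      obtain ⟨r, hr⟩ := exists_smul_eq_algebraMap_smul (x : NakayamaAlgebra k c) j
      have h1 : (x : NakayamaAlgebra k c) • longestPath k hc i = 0 := hx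
      have h2 := hr (longestPath k hc i) (fun l => Subtype.ext ((longestPath k hc i).2 l))
        (e_smul_longestPath hc i)
      rw [h1] at h2
      have hr0 : r = 0 := by
        by_contra hr0
        have := congrArg (algebraMap k (NakayamaAlgebra k c) r⁻¹ • ·) h2
        simp only [← mul_smul, ← map_mul, inv_mul_cancel₀ hr0, map_one, one_smul, smul_zero] at this
        exact longestPath_ne_zero hc i this.symm
      refine (Submodule.Quotient.mk_eq_zero _).1 ((mk_eq_smul_topGenerator x).trans ?_)
      rw [hr _ (topGenerator_mem_arrowSocle j) (e_smul_topGenerator j), hr0, map_zero, zero_smul]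
    exact ⟨((Submodule.quotEquivOfEq _ _ hker).symm.trans
      (f.quotKerEquivOfSurjective hf)).symm⟩

/-- The longest path starting at `i` ends at `i + c i - 1`. -/
theorem shiftedSocles_eq_range (hc : IsKupischSeries c) :
    shiftedSocles k c = Set.range fun i => i + (c i : ZMod n) := by
  have h : ∀ i : ZMod n, i + ((c i - 1 : ℕ) : ZMod n) + 1 = i + (c i : ZMod n) := fun i => by
    rw [add_assoc, ← Nat.cast_add_one, Nat.sub_add_cancel (hc.1 i)]
  ext j
  simp only [shiftedSocles, socles, nonempty_socle_equiv_iff hc, Set.mem_image, Set.mem_range,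
    Set.mem_ofPred_eq]
  constructor
  · rintro ⟨_, ⟨i, rfl⟩, rfl⟩
    exact ⟨i, (h i).symm⟩
  · rintro ⟨i, rfl⟩
    exact ⟨_, ⟨i, rfl⟩, h i⟩

theorem mem_shiftedSocles_repeatSeries (hc : IsKupischSeries c) (m : ℕ) [NeZero m]
    (j : ZMod (m * n)) :
    j ∈ shiftedSocles k (repeatSeries m c) ↔ proj n m j ∈ shiftedSocles k c := by
  rw [shiftedSocles_eq_range hc, shiftedSocles_eq_range (isKupischSeries_repeatSeries m hc)]
  constructor
  · rintro ⟨i, rfl⟩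
    exact ⟨proj n m i, by rw [map_add, map_natCast, repeatSeries_apply]⟩
  · rintro ⟨i, hi⟩
    have h : proj n m (j - (c i : ZMod (m * n))) = i := by
      rw [map_sub, map_natCast, ← hi, add_sub_cancel_right]
    exact ⟨j - (c i : ZMod (m * n)), by
      change _ + ((repeatSeries m c _ : ℕ) : ZMod (m * n)) = j
      rw [repeatSeries_apply, h, sub_add_cancel]⟩

end Socles

end NakayamaAlgebra

/-! ### Endomorphism algebras of projective modules -/

namespace NakayamaAlgebra

section Endomorphisms

variable (k : Type u) [Field k] {n : ℕ} [NeZero n] (c : ZMod n → ℕ) (J : Set (ZMod n))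

/-- The module `⨁ P_j`, over `j` in `J`. -/
abbrev sumP : Type u := ⨁ j : J, P k c j

/-- The sum of the vertices in `J`.  The sum is a `finsum`, so that it does not depend on a
`Fintype` instance on `J`. -/
noncomputable def eSum : NakayamaAlgebra k c := ∑ᶠ j : J, e k c j

open Classical in
/-- The inclusion of `⨁ P_j = Λ e_J` into `Λ`. -/
noncomputable def toRegular : sumP k c J →ₗ[NakayamaAlgebra k c] NakayamaAlgebra k c :=
  DirectSum.toModule _ _ _ fun j => (P k c j).subtype

/-- Right multiplication by the vertex `j`. -/
noncomputable def mulE (j : ZMod n) : NakayamaAlgebra k c →ₗ[NakayamaAlgebra k c] P k c j :=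
  LinearMap.codRestrict _ (LinearMap.toSpanSingleton _ _ (e k c j)) fun a =>
    mem_P_iff.2 (by rw [LinearMap.toSpanSingleton_apply, smul_eq_mul, mul_assoc, e_mul_e_self])

open Classical in
/-- The projection of `Λ` onto `⨁ P_j = Λ e_J`, right multiplication by `e_J`. -/
noncomputable def ofRegular : NakayamaAlgebra k c →ₗ[NakayamaAlgebra k c] sumP k c J :=
  letI := Fintype.ofFinite J
  ∑ j : J, DirectSum.lof _ J (fun j => P k c j) j ∘ₗ mulE k c j

theorem toRegular_ofRegular (a : NakayamaAlgebra k c) :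
    toRegular k c J (ofRegular k c J a) = a * eSum k c J := by
  classical
  let _ := Fintype.ofFinite J
  rw [eSum, finsum_eq_sum_of_fintype, Finset.mul_sum, ofRegular, LinearMap.sum_apply, map_sum]
  exact Finset.sum_congr (Finset.ext fun _ => by simp) fun j _ => DirectSum.toModule_lof _ _ _

theorem ofRegular_toRegular (x : sumP k c J) : ofRegular k c J (toRegular k c J x) = x := by
  classical
  suffices h : ofRegular k c J ∘ₗ toRegular k c J = LinearMap.id from LinearMap.congr_fun h x
  refine DirectSum.linearMap_ext _ fun j => LinearMap.ext fun y => ?_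
  rw [LinearMap.comp_apply, LinearMap.comp_apply, toRegular, DirectSum.toModule_lof,
    Submodule.subtype_apply, ofRegular, LinearMap.sum_apply, Finset.sum_eq_single j]
  · rw [LinearMap.comp_apply]
    exact congrArg _ (Subtype.ext (mem_P_iff.1 y.2))
  · intro j' _ hne
    have h0 : mulE k c j' (y : NakayamaAlgebra k c) = 0 := Subtype.ext (by
      change (y : NakayamaAlgebra k c) * e k c j' = 0
      rw [← mem_P_iff.1 y.2, mul_assoc,
        e_mul_e_of_ne k c fun h => hne (Subtype.ext h.symm), mul_zero])
    rw [LinearMap.comp_apply, h0, map_zero]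
  · exact fun h => absurd (@Finset.mem_univ _ (Fintype.ofFinite J) j) h

/-- The endomorphism of `⨁ P_j = Λ e_J` induced by right multiplication by an element of `Λ`. -/
noncomputable def rightMul :
    NakayamaAlgebra k c →ₗ[k] (Module.End (NakayamaAlgebra k c) (sumP k c J))ᵐᵒᵖ where
  toFun a := MulOpposite.op (ofRegular k c J ∘ₗ LinearMap.toSpanSingleton _ _ a ∘ₗ toRegular k c J)
  map_add' a b := MulOpposite.unop_injective (LinearMap.ext fun x => by simp [mul_add])
  map_smul' r a := MulOpposite.unop_injective (LinearMap.ext fun x => by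
    simp [LinearMap.map_smul_of_tower])

variable {k c J}

theorem rightMul_apply (a : NakayamaAlgebra k c) (x : sumP k c J) :
    (rightMul k c J a).unop x = ofRegular k c J (toRegular k c J x * a) := rfl

theorem rightMul_surjective : Function.Surjective (rightMul k c J) := fun f => by
  refine ⟨toRegular k c J (f.unop (ofRegular k c J 1)),
    MulOpposite.unop_injective (LinearMap.ext fun x => ?_)⟩
  rw [rightMul_apply, ← smul_eq_mul, ← map_smul, ← map_smul, ← map_smul, smul_eq_mul, mul_one,
    ofRegular_toRegular, ofRegular_toRegular]

theorem rightMul_mul (a b : NakayamaAlgebra k c) :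
    rightMul k c J a * rightMul k c J b = rightMul k c J (a * eSum k c J * b) :=
  MulOpposite.unop_injective (LinearMap.ext fun x => by
    rw [MulOpposite.unop_mul, Module.End.mul_apply, rightMul_apply, rightMul_apply, rightMul_apply,
      toRegular_ofRegular, mul_assoc, mul_assoc, mul_assoc])

theorem rightMul_one : rightMul k c J 1 = 1 :=
  MulOpposite.unop_injective (LinearMap.ext fun x => by
    rw [rightMul_apply, mul_one, ofRegular_toRegular]; rfl)

theorem rightMul_mul_eSum (a : NakayamaAlgebra k c) :
    rightMul k c J (a * eSum k c J) = rightMul k c J a := by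
  have := rightMul_mul (J := J) a 1
  rwa [rightMul_one, mul_one, mul_one, eq_comm] at this

theorem rightMul_eSum_mul (a : NakayamaAlgebra k c) :
    rightMul k c J (eSum k c J * a) = rightMul k c J a := by
  have := rightMul_mul (J := J) 1 a
  rwa [rightMul_one, one_mul, one_mul, eq_comm] at this

/-- Right multiplication by `a` on `Λ e_J` is given by `e_J a e_J`. -/
theorem eSum_mul_mul_eSum_eq_zero {a : NakayamaAlgebra k c} (h : rightMul k c J a = 0) :
    eSum k c J * a * eSum k c J = 0 := by
  have := congrArg (fun f => toRegular k c J (f.unop (ofRegular k c J 1))) h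
  simpa [rightMul_apply, toRegular_ofRegular] using this

open Classical in
theorem path_mul_eSum (i : ZMod n) (l : ℕ) :
    path k c i l * eSum k c J = if i ∈ J then path k c i l else 0 := by
  let _ := Fintype.ofFinite J
  rw [eSum, finsum_eq_sum_of_fintype, Finset.mul_sum]
  simp only [path_mul_e]
  split_ifs with h
  · rw [Finset.sum_eq_single ⟨i, h⟩]
    · simp
    · intro j _ hj
      exact if_neg fun h' => hj (Subtype.ext h'.symm)
    · exact fun h => absurd (Finset.mem_univ _) h
  · exact Finset.sum_eq_zero fun j _ => if_neg fun h' : i = j => h (h' ▸ j.2)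

open Classical in
theorem eSum_mul_path (i : ZMod n) (l : ℕ) :
    eSum k c J * path k c i l = if i + (l : ZMod n) ∈ J then path k c i l else 0 := by
  let _ := Fintype.ofFinite J
  rw [eSum, finsum_eq_sum_of_fintype, Finset.sum_mul]
  simp only [e_mul_path]
  split_ifs with h
  · rw [Finset.sum_eq_single ⟨_, h⟩]
    · simp
    · intro j _ hj
      exact if_neg fun h' => hj (Subtype.ext h')
    · exact fun h => absurd (Finset.mem_univ _) h
  · exact Finset.sum_eq_zero fun j _ => if_neg fun h' : (j : ZMod n) = i + l => h (h' ▸ j.2)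

end Endomorphisms

/-- A periodic enumeration of a set `J` of vertices: `s` lists in increasing order the natural
numbers whose residue is in `J`, and `r` is the number of elements of `J`. The series `d` counts,
for the `j`-th vertex in the list, how many composition factors of its projective module are in
`J`. -/
structure PeriodicEnumeration {n r : ℕ} (c : ZMod n → ℕ) (J : Set (ZMod n)) (d : ZMod r → ℕ)
    (s : ℕ → ℕ) : Prop where
  strictMono : StrictMono s
  mem_iff : ∀ x : ℕ, (x : ZMod n) ∈ J ↔ x ∈ Set.range s
  add_period : ∀ j, s (j + r) = s j + n
  lt_iff : ∀ j t : ℕ, t < d (j : ZMod r) ↔ s (j + t) < s j + c (s j : ZMod n)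

namespace PeriodicEnumeration

variable {n r : ℕ} {c : ZMod n → ℕ} {J : Set (ZMod n)} {d : ZMod r → ℕ} {s : ℕ → ℕ}

theorem cast_mem (h : PeriodicEnumeration c J d s) (j : ℕ) : (s j : ZMod n) ∈ J :=
  (h.mem_iff _).2 ⟨j, rfl⟩

theorem cast_add_sub (h : PeriodicEnumeration c J d s) (j t : ℕ) :
    (s j : ZMod n) + ((s (j + t) - s j : ℕ) : ZMod n) = s (j + t) := by
  rw [← Nat.cast_add, Nat.add_sub_cancel' (h.strictMono.monotone (Nat.le_add_right _ _))]

theorem sub_add_sub (h : PeriodicEnumeration c J d s) (j t t' : ℕ) :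
    (s (j + t) - s j) + (s (j + t + t') - s (j + t)) = s (j + (t + t')) - s j := by
  have h1 := h.strictMono.monotone (Nat.le_add_right j t)
  have h2 := h.strictMono.monotone (Nat.le_add_right (j + t) t')
  rw [← add_assoc]
  omega

/-- An equality of functions of the index that only depend on residues. -/
theorem map_mod {β : Type*} {f : ℕ → β} (hf : ∀ j, f (j + r) = f j) (j : ℕ) : f (j % r) = f j :=
  Function.Periodic.map_mod_nat hf j

theorem cast_val_natCast (h : PeriodicEnumeration c J d s) (j : ℕ) :
    (s (j : ZMod r).val : ZMod n) = s j := by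
  rw [ZMod.val_natCast]
  exact map_mod (f := fun j => (s j : ZMod n)) (fun j => by simp [h.add_period]) j

theorem exists_cast_val_eq [NeZero n] (h : PeriodicEnumeration c J d s) {j : ZMod n} (hj : j ∈ J) :
    ∃ i : ZMod r, (s i.val : ZMod n) = j := by
  rw [← ZMod.natCast_zmod_val j, h.mem_iff] at hj
  obtain ⟨t, ht⟩ := hj
  exact ⟨t, by rw [h.cast_val_natCast, ht, ZMod.natCast_zmod_val]⟩

variable [NeZero r]

theorem cast_val_injective (h : PeriodicEnumeration c J d s) :
    Function.Injective fun i : ZMod r => (s i.val : ZMod n) := by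
  have key : ∀ j j' : ℕ, j < j' → j' < r → (s j : ZMod n) ≠ s j' := fun j j' hj hr heq => by
    have h1 := h.strictMono hj
    have h2 := h.strictMono (show j' < j + r by omega)
    rw [h.add_period] at h2
    have h3 := Nat.le_of_dvd (by omega)
      ((Nat.modEq_iff_dvd' h1.le).1 ((ZMod.natCast_eq_natCast_iff _ _ _).1 heq))
    omega
  intro i i' hi
  rcases lt_trichotomy i.val i'.val with hlt | heq | hlt
  · exact absurd hi (key _ _ hlt (ZMod.val_lt i'))
  · exact ZMod.val_injective r heq
  · exact absurd hi.symm (key _ _ hlt (ZMod.val_lt i))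

theorem isKupischSeries (h : PeriodicEnumeration c J d s) (hc : IsKupischSeries c) :
    IsKupischSeries d := by
  constructor
  · intro i
    rw [← ZMod.natCast_zmod_val i, Nat.one_le_iff_ne_zero, ← Nat.pos_iff_ne_zero, h.lt_iff]
    have := hc.1 (s i.val : ZMod n)
    rw [add_zero]
    omega
  · intro i
    by_contra! hlt
    rw [← ZMod.natCast_zmod_val i] at hlt
    set j := i.val
    set t := d ((j : ZMod r) + 1) with ht
    rw [h.lt_iff] at hlt
    refine lt_irrefl t ((ht ▸ Nat.cast_succ (R := ZMod r) j ▸ (h.lt_iff (j + 1) t)).2 ?_)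
    have h1 := le_add_of_kupisch hc.2 (s j : ZMod n) (s (j + 1) - s j)
    rw [h.cast_add_sub] at h1
    have h2 := h.strictMono (Nat.lt_succ_self j)
    rw [show j + 1 + t = j + (t + 1) by ring]
    have h3 : s j.succ = s (j + 1) := rfl
    omega

end PeriodicEnumeration

section EndomorphismAlgebra

variable (k : Type u) [Field k] {n r : ℕ} [NeZero n] {c : ZMod n → ℕ}
  {J : Set (ZMod n)} {d : ZMod r → ℕ} {s : ℕ → ℕ}

variable (c J s) in
/-- The endomorphism of `⨁ P_j` given by right multiplication by the path from the `j`-th to the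
`(j + t)`-th vertex in `J`. -/
noncomputable def endPath (j t : ℕ) : (Module.End (NakayamaAlgebra k c) (sumP k c J))ᵐᵒᵖ :=
  rightMul k c J (path k c (s j) (s (j + t) - s j))

variable (h : PeriodicEnumeration c J d s)

include h

theorem endPath_mul (j t t' : ℕ) :
    endPath k c J s (j + t) t' * endPath k c J s j t = endPath k c J s j (t + t') := by
  classical
  rw [endPath, endPath, endPath, rightMul_mul, path_mul_eSum, if_pos (h.cast_mem _),
    ← h.cast_add_sub, path_mul_path, h.sub_add_sub]

theorem endPath_val_natCast (j t : ℕ) :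
    endPath k c J s (j : ZMod r).val t = endPath k c J s j t := by
  rw [ZMod.val_natCast]
  refine PeriodicEnumeration.map_mod (f := fun j => endPath k c J s j t) (fun j => ?_) j
  rw [endPath, endPath, add_right_comm, h.add_period, h.add_period, Nat.add_sub_add_right,
    Nat.cast_add, ZMod.natCast_self, add_zero]

variable [NeZero r]

theorem endPath_val_add (i : ZMod r) (t t' : ℕ) :
    endPath k c J s (i + (t : ZMod r)).val t' = endPath k c J s (i.val + t) t' := by
  rw [← endPath_val_natCast k h (i.val + t), Nat.cast_add, ZMod.natCast_zmod_val]

theorem genPath_endPath (i : ZMod r) (l : ℕ) :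
    genPath (fun i => endPath k c J s i.val 0) (fun i => endPath k c J s i.val 1) i l =
      endPath k c J s i.val l := by
  induction l with
  | zero => rfl
  | succ l ih => rw [genPath, ih, endPath_val_add k h, endPath_mul k h]

/-- The endomorphisms of `⨁ P_j` given by the paths between consecutive vertices in `J`. -/
noncomputable def endRealization :
    Realization k d (Module.End (NakayamaAlgebra k c) (sumP k c J))ᵐᵒᵖ where
  E i := endPath k c J s i.val 0
  A i := endPath k c J s i.val 1
  idem i := endPath_mul k h i.val 0 0
  orth i i' hne := by
    classical
    rw [endPath, endPath, rightMul_mul, path_mul_eSum, if_pos (h.cast_mem _)]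
    simp only [add_zero, Nat.sub_self, path_zero]
    rw [e_mul_e_of_ne k c fun h' => hne (h.cast_val_injective h'), map_zero]
  sum_vertex := by
    classical
    let _ := Fintype.ofFinite J
    rw [← rightMul_one, ← rightMul_mul_eSum, one_mul, eSum, finsum_eq_sum_of_fintype, map_sum]
    refine Finset.sum_bij (fun i _ => ⟨(s i.val : ZMod n), h.cast_mem _⟩)
      (fun _ _ => Finset.mem_univ _) (fun i _ i' _ hi => h.cast_val_injective (congrArg Subtype.val hi))
      (fun j _ => ?_) (fun i _ => ?_)
    · obtain ⟨i, hi⟩ := h.exists_cast_val_eq j.2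
      exact ⟨i, Finset.mem_univ _, Subtype.ext hi⟩
    · rw [endPath, add_zero, Nat.sub_self, path_zero]
  source i := endPath_mul k h i.val 0 1
  target i := by
    have h1 := endPath_val_add k h i 1 0
    rw [Nat.cast_one] at h1
    rw [h1]
    exact endPath_mul k h i.val 1 0
  zero i := by
    rw [genPath_endPath k h, endPath, path_eq_zero, map_zero]
    have h1 := (h.lt_iff i.val (d i)).not.1 (by rw [ZMod.natCast_zmod_val]; exact lt_irrefl _)
    omega

theorem endRealization_lift_path (j t : ℕ) :
    (endRealization k h).lift (path k d (j : ZMod r) t) = endPath k c J s j t := by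
  rw [Realization.lift_path]
  exact (genPath_endPath k h _ _).trans (endPath_val_natCast k h _ _)

/-- A path between two vertices in `J` is a product of paths between consecutive vertices in `J`. -/
theorem endRealization_lift_surjective :
    Function.Surjective (endRealization k h).lift := by
  classical
  have hpath : ∀ i l, rightMul k c J (path k c i l) ∈ (endRealization k h).lift.range := by
    intro i l
    rw [← rightMul_mul_eSum, path_mul_eSum]
    split_ifs with hi
    swap
    · rw [map_zero]; exact Subalgebra.zero_mem _
    rw [← rightMul_eSum_mul, eSum_mul_path]
    split_ifs with hil
    swap
    · rw [map_zero]; exact Subalgebra.zero_mem _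
    obtain ⟨i, rfl⟩ := h.exists_cast_val_eq hi
    rw [← Nat.cast_add, h.mem_iff] at hil
    obtain ⟨u, hu⟩ := hil
    obtain ⟨t, rfl⟩ := Nat.exists_eq_add_of_le (h.strictMono.le_iff_le.1
      (hu ▸ Nat.le_add_right _ _ : s i.val ≤ s u))
    refine ⟨path k d (i.val : ZMod r) t, ?_⟩
    have := endRealization_lift_path k h i.val t
    rw [endPath, hu, Nat.add_sub_cancel_left] at this
    exact this
  intro f
  obtain ⟨a, rfl⟩ := rightMul_surjective f
  have ha : a ∈ Submodule.span k {a | ∃ i l, l < c i ∧ a = path k c i l} := by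
    rw [span_path]; trivial
  change _ ∈ (endRealization k h).lift.range
  induction ha using Submodule.span_induction with
  | mem x hx =>
    obtain ⟨i, l, -, rfl⟩ := hx
    exact hpath i l
  | zero => rw [map_zero]; exact Subalgebra.zero_mem _
  | add x y _ _ hx hy => rw [map_add]; exact Subalgebra.add_mem _ hx hy
  | smul a x _ hx => rw [map_smul]; exact Subalgebra.smul_mem _ hx a

/-- The paths of the Nakayama algebra of `d` are sent to distinct nonzero paths of `Λ` between
vertices in `J`. -/
theorem endRealization_lift_injective (hc : IsKupischSeries c) :
    Function.Injective (endRealization k h).lift := by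
  classical
  rw [injective_iff_map_eq_zero]
  intro a ha
  choose f hf using fun i => mul_e_eq_sum a i
  have hsum : a = ∑ i, ∑ t ∈ Finset.range (d i), f i t • path k d i t := by
    simp only [← hf]
    rw [← Finset.mul_sum, sum_e, mul_one]
  set b : NakayamaAlgebra k c := ∑ i : ZMod r, ∑ t ∈ Finset.range (d i),
    f i t • path k c (s i.val) (s (i.val + t) - s i.val) with hb
  have hlift : rightMul k c J b = 0 := by
    rw [← ha, hsum, hb]
    simp only [map_sum, map_smul]
    refine Finset.sum_congr rfl fun i _ => Finset.sum_congr rfl fun t _ => ?_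
    rw [← endPath, ← endRealization_lift_path k h, ZMod.natCast_zmod_val]
  have hb0 : b = 0 := by
    rw [← eSum_mul_mul_eSum_eq_zero hlift, hb]
    simp only [Finset.mul_sum, Finset.sum_mul, mul_smul_comm, smul_mul_assoc]
    refine Finset.sum_congr rfl fun i _ => Finset.sum_congr rfl fun t _ => ?_
    rw [eSum_mul_path, h.cast_add_sub, if_pos (h.cast_mem _), path_mul_eSum, if_pos (h.cast_mem _)]
  have hlt : ∀ i t, t ∈ Finset.range (d i) → s (i.val + t) - s i.val < c (s i.val) := by
    intro i t ht
    rw [Finset.mem_range, ← ZMod.natCast_zmod_val i, h.lt_iff] at ht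
    have := h.strictMono.monotone (Nat.le_add_right i.val t)
    omega
  -- The pairs `(i, t)` index distinct basis paths, so the coefficients of `b` can be compared.
  have hf0 : ∀ i t, t ∈ Finset.range (d i) → f i t = 0 := by
    intro i t ht
    have h1 := congrArg (fun x => coord hc x ((s i.val : ZMod n), s (i.val + t) - s i.val)) hb0
    simp only [hb, map_sum, map_smul, map_zero, Finsupp.finsetSum_apply, Finsupp.smul_apply,
      Finsupp.zero_apply] at h1
    rw [Finset.sum_eq_single i, Finset.sum_eq_single t, coord_path hc _ (hlt i t ht),
      Finsupp.single_eq_same, smul_eq_mul, mul_one] at h1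
    · exact h1
    · intro t' ht' hne
      rw [coord_path hc _ (hlt i t' ht'), Finsupp.single_apply, if_neg, smul_zero]
      intro heq
      have h2 := h.strictMono.monotone (Nat.le_add_right i.val t)
      have h3 := h.strictMono.monotone (Nat.le_add_right i.val t')
      have h4 := (Prod.mk.inj heq).2
      have h5 := h.strictMono.injective (show s (i.val + t') = s (i.val + t) by omega)
      exact hne (by omega)
    · exact fun h' => absurd ht h'
    · intro i' _ hne
      refine Finset.sum_eq_zero fun t' ht' => ?_
      rw [coord_path hc _ (hlt i' t' ht'), Finsupp.single_apply, if_neg, smul_zero]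
      exact fun heq => hne (h.cast_val_injective (Prod.mk.inj heq).1)
    · exact fun h' => absurd (Finset.mem_univ _) h'
  rw [hsum]
  exact Finset.sum_eq_zero fun i _ => Finset.sum_eq_zero fun t ht => by rw [hf0 i t ht, zero_smul]

/-- The opposite of the endomorphism algebra of `⨁ P_j`, over `j` in `J`, is the Nakayama algebra
of the series `d` that counts composition factors in `J`. -/
noncomputable def endEquiv (hc : IsKupischSeries c) :
    (Module.End (NakayamaAlgebra k c) (sumP k c J))ᵐᵒᵖ ≃ₐ[k] NakayamaAlgebra k d :=
  (AlgEquiv.ofBijective (endRealization k h).lift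
    ⟨endRealization_lift_injective k h hc, endRealization_lift_surjective k h⟩).symm

end EndomorphismAlgebra

/-! ### Coverings of syzygy filtered algebras -/

section PeriodicEnumeration

/-- The natural numbers with residue in `J` are enumerated by `Nat.nth`, and the number of them in an
interval is a difference of values of `Nat.count`. -/
theorem exists_periodicEnumeration {n : ℕ} [NeZero n] (c : ZMod n → ℕ) {J : Set (ZMod n)}
    (hJ : J.Nonempty) : ∃ (r : ℕ) (_ : NeZero r) (d : ZMod r → ℕ) (s : ℕ → ℕ),
      PeriodicEnumeration c J d s := by
  classical
  set p : ℕ → Prop := fun x => (x : ZMod n) ∈ J with hp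
  have hper : ∀ x, p (n + x) ↔ p x := fun x => by simp [hp]
  have hinf : (Set.ofPred p).Infinite := by
    obtain ⟨j, hj⟩ := hJ
    refine Set.infinite_of_injective_forall_mem (f := fun t : ℕ => j.val + n * t)
      (fun t t' h => ?_) (fun t => ?_)
    · exact Nat.eq_of_mul_eq_mul_left (NeZero.pos n) (Nat.add_left_cancel h)
    · change ((j.val + n * t : ℕ) : ZMod n) ∈ J
      simpa using hj
  have hmono : StrictMono (Nat.nth p) := Nat.nth_strictMono hinf
  have hmem : ∀ j, p (Nat.nth p j) := Nat.nth_mem_of_infinite hinf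
  have hadd : ∀ j, Nat.nth p (j + Nat.count p n) = Nat.nth p j + n := by
    intro j
    have h1 : Nat.count p (n + Nat.nth p j) = Nat.count p n + j := by
      rw [Nat.count_add]
      simp only [hper]
      rw [Nat.count_nth_of_infinite hinf]
    rw [add_comm j, ← h1, Nat.nth_count ((hper _).2 (hmem j)), add_comm]
  have hr : Nat.count p n ≠ 0 := fun h0 => by
    have := hadd 0
    rw [h0, add_zero] at this
    have := NeZero.pos n
    omega
  have : NeZero (Nat.count p n) := ⟨hr⟩
  refine ⟨Nat.count p n, this, fun i => Nat.count p (Nat.nth p i.val + c (Nat.nth p i.val)) - i.val,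
    Nat.nth p, hmono, fun x => ?_, hadd, fun j t => ?_⟩
  · rw [Nat.range_nth_of_infinite hinf]; rfl
  · have h1 : ∀ j : ℕ, t < Nat.count p (Nat.nth p j + c (Nat.nth p j)) - j ↔
        Nat.nth p (j + t) < Nat.nth p j + c (Nat.nth p j) := fun j => by
      rw [← not_le (a := Nat.nth p j + _), ← Nat.count_le_iff_le_nth hinf, not_le]
      omega
    rw [h1, ZMod.val_natCast]
    refine iff_of_eq (PeriodicEnumeration.map_mod (f := fun j =>
      Nat.nth p (j + t) < Nat.nth p j + c (Nat.nth p j : ZMod n)) (fun j => ?_) j)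
    rw [add_right_comm, hadd, hadd, Nat.cast_add, ZMod.natCast_self, add_zero, add_right_comm]
    simp

/-- The preimage of `J` in the covering has the same enumeration as `J`, with a longer period. -/
theorem PeriodicEnumeration.repeatSeries {n r : ℕ} {c : ZMod n → ℕ} {J : Set (ZMod n)}
    {d : ZMod r → ℕ} {s : ℕ → ℕ} (h : PeriodicEnumeration c J d s) (m : ℕ)
    {J' : Set (ZMod (m * n))} (hJ' : ∀ j, j ∈ J' ↔ proj n m j ∈ J) :
    PeriodicEnumeration (repeatSeries m c) J' (repeatSeries m d) s where
  strictMono := h.strictMono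
  mem_iff x := by rw [hJ', map_natCast, h.mem_iff]
  add_period j := by
    clear hJ' J'
    induction m with
    | zero => simp
    | succ m ih => rw [Nat.succ_mul, Nat.succ_mul, ← add_assoc, h.add_period, ih, add_assoc]
  lt_iff j t := by
    rw [repeatSeries_apply, repeatSeries_apply, map_natCast, map_natCast, h.lt_iff]

end PeriodicEnumeration

/-- Both algebras are determined by the same enumeration, regarded with periods `r` and `m * r`. -/
theorem isCovering_syzygyFiltered (k : Type u) [Field k] {n : ℕ} [NeZero n] {c : ZMod n → ℕ}
    (hc : IsKupischSeries c) (m : ℕ) [NeZero m] :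
    IsCovering k m (syzygyFiltered k (repeatSeries m c)) (syzygyFiltered k c) := by
  have hJ : (shiftedSocles k c).Nonempty := by
    rw [shiftedSocles_eq_range hc]; exact Set.range_nonempty _
  obtain ⟨r, _, d, s, h⟩ := exists_periodicEnumeration c hJ
  exact ⟨r, ‹_›, d, h.isKupischSeries hc, ⟨endEquiv k h hc⟩,
    ⟨endEquiv k (h.repeatSeries m (mem_shiftedSocles_repeatSeries hc m))
      (isKupischSeries_repeatSeries m hc)⟩⟩

end NakayamaAlgebra

theorem mainTheorem6 (k : Type u) [Field k] (n : ℕ) [NeZero n] (c : ZMod n → ℕ)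
    (hc : IsCyclicKupischSeries c) (m : ℕ) [NeZero m] :
    IsCovering k m (NakayamaAlgebra.syzygyFiltered k (repeatSeries m c))
        (NakayamaAlgebra.syzygyFiltered k c) ∧
      (IsHigherAuslander (NakayamaAlgebra k c) →
        IsHigherAuslander (NakayamaAlgebra k (repeatSeries m c)) ∧
          globalDimension (NakayamaAlgebra k (repeatSeries m c)) =
            globalDimension (NakayamaAlgebra k c)) :=
  ⟨NakayamaAlgebra.isCovering_syzygyFiltered k hc.isKupischSeries m, fun h =>
    ⟨NakayamaAlgebra.isHigherAuslander_repeatSeries m hc h,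
      NakayamaAlgebra.globalDimension_repeatSeries k m hc.isKupischSeries.1⟩⟩
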